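/- Let $M$ be a non-empty compact (Hausdorff) smooth manifold of dimension $n$ without boundary, and let $c:M\times M\to\mathbb{R}$ be a continuous function (the cost). A family of functions $f_\alpha:M\to\mathbb{R}$, $\alpha\in A$, is called equi-locally semiconcave if $M$ is covered by finitely many smooth coordinate patches $\varphi_i(U_i)$, with $U_i\subset\mathbb{R}^n$ open and convex, and there are constants $K_i\in\mathbb{R}$ such that for every $i$ and every $\alpha\in A$ the function $z\mapsto f_\alpha(\varphi_i(z))-K_i\|z\|^2$ is concave on $U_i$ (Euclidean norm). Assume that the families $\{c(x,\cdot)\}_{x\in M}$ and $\{c(\cdot,y)\}_{y\in M}$ are both equi-locally semiconcave. Let $T^-u(x)=\inf_{y\in M}\big(u(y)+c(y,x)\big)$ for bounded $u:M\to\mathbb{R}$, and let $c[0]$ be the critical value of $c$, that is, the unique constant $C\in\mathbb{R}$ for which the equation $u=T^-u+C$ has a bounded solution $u:M\to\mathbb{R}$ (such a constant exists and is unique). A critical subsolution is a function $u:M\to\mathbb{R}$ such that $u(y)-u(x)\le c(x,y)+c[0]$ for all $x,y\in M$. Then there exists a critical subsolution $u_1:M\to\mathbb{R}$ that is strict, meaning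 that whenever $u_1(y)-u_1(x)=c(x,y)+c[0]$ for some $(x,y)\in M\times M$, every critical subsolution $u$ satisfies $u(y)-u(x)=c(x,y)+c[0]$, and that is of class $C^{1,1}$, i.e. $u_1$ is $C^1$ and its differential is locally Lipschitz in every smooth chart (equivalently, as $M$ is compact, $u_1$ is $C^1$ with Lipschitz differential). -/

import Mathlib

open scoped Manifold ContDiff

/-- The (negative) Lax--Oleinik operator `T⁻ f (x) = inf_y (f y + c (y, x))`, to be used
for bounded functions `f`. -/
noncomputable def laxOleinik {X : Type*} (c : X → X → ℝ) (f : X → ℝ) (x : X) : ℝ :=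
  ⨅ y, f y + c y x

/-- `u` is a bounded solution of `u = T⁻ u + C`. (For a bounded cost every real-valued solution
of this equation is bounded, since `T⁻ u ≡ -∞` for `u` unbounded from below and `T⁻ u` is bounded
otherwise.) -/
def IsWeakKAMSolution {X : Type*} (c : X → X → ℝ) (C : ℝ) (u : X → ℝ) : Prop :=
  BddBelow (Set.range u) ∧ BddAbove (Set.range u) ∧ ∀ x, u x = laxOleinik c u x + C

/-- `c₀` is the critical value `c[0]` of the cost `c`: the unique constant `C` for which
`u = T⁻ u + C` admits solutions. -/
def IsCriticalValue {X : Type*} (c : X → X → ℝ) (c₀ : ℝ) : Prop :=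
  (∃ u, IsWeakKAMSolution c c₀ u) ∧ ∀ C, (∃ u, IsWeakKAMSolution c C u) → C = c₀

/-- `v` is a `C`-subsolution for the cost `c`; no regularity of `v` is required. -/
def IsSubsolution {X : Type*} (c : X → X → ℝ) (C : ℝ) (v : X → ℝ) : Prop :=
  ∀ x y, v y - v x ≤ c x y + C

/-- `v` is a strict `C`-subsolution: equality in the subsolution inequality at some pair `(x, y)`
forces equality at `(x, y)` for every `C`-subsolution. Used with `C` the critical value. -/
def IsStrictSubsolution {X : Type*} (c : X → X → ℝ) (C : ℝ) (v : X → ℝ) : Prop :=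
  IsSubsolution c C v ∧
    ∀ x y, v y - v x = c x y + C → ∀ u, IsSubsolution c C u → u y - u x = c x y + C

/-- `f` is `K`-semiconcave on `Ω`: `x ↦ f x - K ‖x‖²` is concave on `Ω`, with the Euclidean norm
(convexity of `Ω` is part of `ConcaveOn`). -/
def IsSemiconcaveOn {n : ℕ} (K : ℝ) (Ω : Set (EuclideanSpace ℝ (Fin n)))
    (f : EuclideanSpace ℝ (Fin n) → ℝ) : Prop :=
  ConcaveOn ℝ Ω fun x => f x - K * ‖x‖ ^ 2

/-- The family `f` of functions on the smooth `n`-manifold `M` is equi-locally semiconcave: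
`M` is covered by the domains of finitely many smooth charts `φ i` with (convex, open) images
`(φ i).target` in `ℝⁿ`, and every `f a`, read in the chart `φ i`, is `K i`-semiconcave with `K i`
independent of `a`. -/
def EquiLocallySemiconcave (n : ℕ) {M A : Type*} [TopologicalSpace M]
    [ChartedSpace (EuclideanSpace ℝ (Fin n)) M] (f : A → M → ℝ) : Prop :=
  ∃ (m : ℕ) (φ : Fin m → OpenPartialHomeomorph M (EuclideanSpace ℝ (Fin n))) (K : Fin m → ℝ),
    (∀ i, φ i ∈ IsManifold.maximalAtlas (𝓡 n) ∞ M) ∧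
    (⋃ i, (φ i).source) = Set.univ ∧
    ∀ i a, IsSemiconcaveOn (K i) (φ i).target (f a ∘ (φ i).symm)

/-- `u : M → ℝ` is `C^{1,1}`: it is `C¹` and, in every smooth chart, its differential is locally
Lipschitz. (On a compact manifold this amounts to a Lipschitz differential.) -/
def IsC11 (n : ℕ) {M : Type*} [TopologicalSpace M]
    [ChartedSpace (EuclideanSpace ℝ (Fin n)) M] (u : M → ℝ) : Prop :=
  ContMDiff (𝓡 n) 𝓘(ℝ, ℝ) 1 u ∧
    ∀ φ ∈ IsManifold.maximalAtlas (𝓡 n) ∞ M,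
      LocallyLipschitzOn φ.target (fderiv ℝ (u ∘ φ.symm))

/-! ### Weak KAM theory: Lax–Oleinik operators, the critical value, strict subsolutions. -/

section WeakKAM

open Set Filter Topology

variable {X : Type*} {c : X → X → ℝ} {C : ℝ} {u : X → ℝ}

/-! Start from a continuous strict critical subsolution `u` and regularize it without losing
strictness. Put `g = T⁻ u + C` and `f = T⁺ g - C`. Then `f ≤ u ≤ g`, and by definition of `T⁺` one
has `g y - f x ≤ c x y + C` for all `x`, `y`. Every `w` with `f ≤ w ≤ g` is therefore a subsolution.
If moreover `f < w < g` wherever `f < g`, then equality for `w` at `(x, y)` forces `w x = f x` and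
`w y = g y`, hence `f = u = w = g` at both points, so `u` has equality at `(x, y)` too and
strictness passes to `w` (`IsStrictSubsolution.of_between`).

An infimum of functions with a common semiconcavity constant is semiconcave, so `g` and `-f` are
locally semiconcave. What remains is Ilmanen's lemma (`exists_isC11_between`): between a semiconvex
`f` and a semiconcave `g ≥ f` lies a `C^{1,1}` function, strictly between them where `f < g`. In
Euclidean space it comes from the convex envelope of `G + K ‖·‖²`, whose second differences are
bounded on both sides; averaging with the mirror construction gives strictness on both sides. On the
manifold one inserts between `ρ f` and `ρ g` for each member `ρ` of a partition of unity and adds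
up.

The constant `C` is the least one admitting subsolutions. A strict subsolution is a countable convex
combination of continuous ones, chosen by the Lindelöf property. Minimality of `C` forces equality
at some pair, and a maximal subsolution normalized at the second point of that pair is a weak KAM
solution, so `C` is the critical value. -/

/-- The positive Lax--Oleinik operator `T⁺ f (x) = sup_y (f y - c (x, y))`, written through
the negative operator of the transposed cost. -/
noncomputable def laxOleinikPos (c : X → X → ℝ) (f : X → ℝ) (x : X) : ℝ :=
  -laxOleinik (fun a b => c b a) (fun y => -f y) x

theorem bddBelow_range_add_of_bounded (hcb : ∃ B, ∀ x y, |c x y| ≤ B)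
    (hub : ∃ D, ∀ x, |u x| ≤ D) (x : X) : BddBelow (range fun y => u y + c y x) := by
  obtain ⟨B, hB⟩ := hcb
  obtain ⟨D, hD⟩ := hub
  refine ⟨-D - B, ?_⟩
  rintro _ ⟨y, rfl⟩
  have h₁ := neg_le_of_abs_le (hB y x)
  have h₂ := neg_le_of_abs_le (hD y)
  simp only
  linarith

theorem laxOleinik_le (hcb : ∃ B, ∀ x y, |c x y| ≤ B) (hub : ∃ D, ∀ x, |u x| ≤ D) (x y : X) :
    laxOleinik c u y ≤ u x + c x y :=
  ciInf_le (bddBelow_range_add_of_bounded hcb hub y) x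

theorem le_laxOleinikPos (hcb : ∃ B, ∀ x y, |c x y| ≤ B) (hub : ∃ D, ∀ x, |u x| ≤ D) (x y : X) :
    u y - c x y ≤ laxOleinikPos c u x := by
  obtain ⟨B, hB⟩ := hcb
  obtain ⟨D, hD⟩ := hub
  have := laxOleinik_le (c := fun a b => c b a) (u := fun y => -u y) ⟨B, fun x y => hB y x⟩
    ⟨D, fun x => by rw [abs_neg]; exact hD x⟩ y x
  unfold laxOleinikPos
  linarith

section Nonempty

variable [Nonempty X]

theorem IsSubsolution.bounded (hu : IsSubsolution c C u) (hcb : ∃ B, ∀ x y, |c x y| ≤ B) :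
    ∃ D, ∀ x, |u x| ≤ D := by
  obtain ⟨B, hB⟩ := hcb
  obtain ⟨x₀⟩ := ‹Nonempty X›
  refine ⟨|u x₀| + (B + C), fun x => ?_⟩
  have h₁ := hu x x₀
  have h₂ := hu x₀ x
  have h₃ := le_of_abs_le (hB x x₀)
  have h₄ := le_of_abs_le (hB x₀ x)
  rw [abs_le]
  constructor
  · linarith [neg_abs_le (u x₀)]
  · linarith [le_abs_self (u x₀)]

theorem le_laxOleinik {a : ℝ} {x : X} (h : ∀ y, a ≤ u y + c y x) : a ≤ laxOleinik c u x :=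
  le_ciInf h

theorem laxOleinikPos_le {a : ℝ} {x : X} (h : ∀ y, u y - c x y ≤ a) :
    laxOleinikPos c u x ≤ a := by
  have : -a ≤ laxOleinik (fun a b => c b a) (fun y => -u y) x :=
    le_laxOleinik fun y => by linarith [h y]
  unfold laxOleinikPos
  linarith

theorem IsSubsolution.le_laxOleinik_add (hu : IsSubsolution c C u) (x : X) :
    u x ≤ laxOleinik c u x + C := by
  have : u x - C ≤ laxOleinik c u x := le_laxOleinik fun y => by linarith [hu y x]
  linarith

theorem IsSubsolution.laxOleinikPos_sub_le (hu : IsSubsolution c C u) (x : X) :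
    laxOleinikPos c u x - C ≤ u x := by
  have : laxOleinikPos c u x ≤ u x + C := laxOleinikPos_le fun y => by linarith [hu x y]
  linarith

theorem IsSubsolution.laxOleinik (hu : IsSubsolution c C u) (hcb : ∃ B, ∀ x y, |c x y| ≤ B) :
    IsSubsolution c C fun x => laxOleinik c u x + C := fun x y => by
  have h₁ := laxOleinik_le hcb (hu.bounded hcb) x y
  have h₂ := hu.le_laxOleinik_add x
  linarith

theorem IsSubsolution.laxOleinikPos (hu : IsSubsolution c C u)
    (hcb : ∃ B, ∀ x y, |c x y| ≤ B) :
    IsSubsolution c C fun x => laxOleinikPos c u x - C := fun x y => by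
  have h₁ := le_laxOleinikPos hcb (hu.bounded hcb) x y
  have h₂ := hu.laxOleinikPos_sub_le y
  linarith

/-- A strict subsolution is obtained from any function lying strictly between `T⁺ T⁻ u` and
`T⁻ u + C`, with `u` a strict subsolution. -/
theorem IsStrictSubsolution.of_between (hcb : ∃ B, ∀ x y, |c x y| ≤ B)
    (hu : IsStrictSubsolution c C u) {f g w : X → ℝ}
    (hg : ∀ x, g x = laxOleinik c u x + C) (hf : ∀ x, f x = laxOleinikPos c g x - C)
    (hfw : ∀ x, f x ≤ w x) (hwg : ∀ x, w x ≤ g x) 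
    (hlt : ∀ x, f x < g x → f x < w x ∧ w x < g x) :
    IsStrictSubsolution c C w := by
  have hgs : IsSubsolution c C g := by
    rw [funext hg]
    exact hu.1.laxOleinik hcb
  have hug : ∀ x, u x ≤ g x := fun x => by rw [hg]; exact hu.1.le_laxOleinik_add x
  have hfu : ∀ x, f x ≤ u x := fun x => by
    have : laxOleinikPos c g x ≤ u x + C := laxOleinikPos_le fun y => by
      rw [hg]
      linarith [laxOleinik_le hcb (hu.1.bounded hcb) x y]
    linarith [hf x]
  -- This joint inequality is stronger than both `f` and `g` being subsolutions: it leaves room for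
  -- any `w` in between.
  have hgf : ∀ x y, g y - f x ≤ c x y + C := fun x y => by
    linarith [hf x, le_laxOleinikPos hcb (hgs.bounded hcb) x y]
  refine ⟨fun x y => by linarith [hgf x y, hfw x, hwg y], fun x y hxy => hu.2 x y ?_⟩
  have hx : f x = g x := by
    by_contra hne
    have := hlt x (lt_of_le_of_ne ((hfw x).trans (hwg x)) hne)
    linarith [hgf x y, hwg y]
  have hy : f y = g y := by
    by_contra hne
    have := hlt y (lt_of_le_of_ne ((hfw y).trans (hwg y)) hne)
    linarith [hgf x y, hfw x]
  linarith [hug x, hug y, hfu x, hfu y, hfw x, hwg x, hfw y, hwg y]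

end Nonempty

section Compact

variable [TopologicalSpace X] [CompactSpace X]

theorem exists_abs_le_of_continuous_cost (hc : Continuous fun p : X × X => c p.1 p.2) :
    ∃ B, ∀ x y, |c x y| ≤ B := by
  obtain ⟨B, hB⟩ := isCompact_univ.exists_bound_of_continuousOn hc.continuousOn
  exact ⟨B, fun x y => by simpa using hB (x, y) (mem_univ _)⟩

/-- Compactness in `y` (tube lemma) makes the functions `c y ·` equicontinuous at `x₀`; hence
Lax–Oleinik images are continuous even when `u` is not. -/
theorem eventually_forall_abs_sub_lt (hc : Continuous fun p : X × X => c p.1 p.2) (x₀ : X)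
    {ε : ℝ} (hε : 0 < ε) : ∀ᶠ x in 𝓝 x₀, ∀ y, |c y x - c y x₀| < ε := by
  have h : ∀ y ∈ (univ : Set X), ∀ᶠ p : X × X in 𝓝 y ×ˢ 𝓝 x₀, |c p.1 p.2 - c p.1 x₀| < ε := by
    intro y _
    rw [← nhds_prod_eq]
    have h₁ : Continuous fun p : X × X => |c p.1 p.2 - c p.1 x₀| :=
      (hc.sub (hc.comp (continuous_fst.prodMk continuous_const))).abs
    exact h₁.continuousAt.eventually_lt continuousAt_const (by simpa using hε)
  have := isCompact_univ.eventually_forall_of_forall_eventually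
    (x₀ := x₀) (P := fun x y => |c y x - c y x₀| < ε) (by
      intro y hy
      have := h y hy
      rw [nhds_prod_eq]
      exact (eventually_swap_iff.1 this))
  simpa using this

variable [Nonempty X]

theorem continuous_laxOleinik (hc : Continuous fun p : X × X => c p.1 p.2)
    (hub : ∃ D, ∀ x, |u x| ≤ D) : Continuous (laxOleinik c u) := by
  have hcb := exists_abs_le_of_continuous_cost hc
  rw [continuous_iff_continuousAt]
  intro x₀
  rw [ContinuousAt, Metric.tendsto_nhds]
  intro ε hε
  filter_upwards [eventually_forall_abs_sub_lt hc x₀ (half_pos hε)] with x hx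
  have h₁ : laxOleinik c u x₀ - ε / 2 ≤ laxOleinik c u x := le_laxOleinik fun y => by
    have := laxOleinik_le hcb hub y x₀
    linarith [(abs_lt.1 (hx y)).1]
  have h₂ : laxOleinik c u x - ε / 2 ≤ laxOleinik c u x₀ := le_laxOleinik fun y => by
    have := laxOleinik_le hcb hub y x
    linarith [(abs_lt.1 (hx y)).2]
  rw [Real.dist_eq, abs_lt]
  constructor <;> linarith

theorem continuous_laxOleinikPos (hc : Continuous fun p : X × X => c p.1 p.2)
    (hub : ∃ D, ∀ x, |u x| ≤ D) : Continuous (laxOleinikPos c u) := by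
  obtain ⟨D, hD⟩ := hub
  exact (continuous_laxOleinik (c := fun a b => c b a) (hc.comp continuous_swap)
    ⟨D, fun x => by rw [abs_neg]; exact hD x⟩).neg

/-- There is a least constant for which subsolutions exist. -/
theorem exists_isLeast_isSubsolution (hc : Continuous fun p : X × X => c p.1 p.2) :
    ∃ c₀, IsLeast {C | ∃ u, IsSubsolution c C u} c₀ := by
  obtain ⟨B, hB⟩ := exists_abs_le_of_continuous_cost hc
  have x₀ : X := Classical.arbitrary X
  set S : Set ℝ := {C | ∃ u, IsSubsolution c C u} with hS
  have hne : S.Nonempty := ⟨B, fun _ => 0, fun x y => by linarith [neg_le_of_abs_le (hB x y)]⟩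
  have hbdd : BddBelow S := by
    refine ⟨-B, ?_⟩
    rintro C ⟨u, hu⟩
    linarith [hu x₀ x₀, le_of_abs_le (hB x₀ x₀)]
  refine ⟨sInf S, ?_, fun C hC => csInf_le hbdd hC⟩
  obtain ⟨s, -, hs, hsS⟩ := exists_seq_tendsto_sInf hne hbdd
  choose v hv using hsS
  obtain ⟨R, hR⟩ := hs.bddAbove_range
  have hsR : ∀ k, s k ≤ R := fun k => hR ⟨k, rfl⟩
  -- Subsolutions carry no regularity here, so only a pointwise limit is needed; an ultrafilter
  -- provides it at all points simultaneously.
  have hlim : ∀ x, ∃ l, Tendsto (fun k => v k x - v k x₀) (hyperfilter ℕ : Filter ℕ) (𝓝 l) := by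
    intro x
    have hmem : ∀ k, v k x - v k x₀ ∈ Icc (-(B + R)) (B + R) := fun k =>
      ⟨by linarith [hv k x x₀, le_of_abs_le (hB x x₀), hsR k],
        by linarith [hv k x₀ x, le_of_abs_le (hB x₀ x), hsR k]⟩
    obtain ⟨l, -, hl⟩ := isCompact_Icc.ultrafilter_le_nhds
      ((hyperfilter ℕ).map fun k => v k x - v k x₀)
      (by
        rw [le_principal_iff]
        exact Filter.mem_map.2 (univ_mem' hmem))
    exact ⟨l, hl⟩
  choose w hw using hlim
  refine ⟨w, fun x y => ?_⟩
  have hs' : Tendsto s (hyperfilter ℕ : Filter ℕ) (𝓝 (sInf S)) :=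
    hs.mono_left (by rw [← Nat.cofinite_eq_atTop]; exact hyperfilter_le_cofinite)
  exact le_of_tendsto_of_tendsto ((hw y).sub (hw x)) (hs'.const_add (c x y))
    (Eventually.of_forall fun k => by
      have := hv k x y
      simp only
      linarith)

/-- If a subsolution is not an equality at `(x, y)`, then neither is some continuous one. -/
theorem IsSubsolution.exists_continuous_lt (hc : Continuous fun p : X × X => c p.1 p.2)
    (hu : IsSubsolution c C u) {x y : X} (h : u y - u x < c x y + C) :
    ∃ v, Continuous v ∧ IsSubsolution c C v ∧ v y - v x < c x y + C := by
  have hcb := exists_abs_le_of_continuous_cost hc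
  have hp := hu.laxOleinikPos hcb
  have hpc : Continuous fun x => _root_.laxOleinikPos c u x - C :=
    (continuous_laxOleinikPos hc (hu.bounded hcb)).sub continuous_const
  -- Let `v = T⁺ u - C ≤ u`. If `v x = u x`, then `v y - v x ≤ u y - u x` keeps the gap. If `v x < u
  -- x`, pass to `T⁻ v + C`: it is at least `u x` at `x`, and at most `v x + c x y + C` at `y`.
  rcases (hu.laxOleinikPos_sub_le x).eq_or_lt with he | hlt
  · exact ⟨_, hpc, hp, by linarith [hu.laxOleinikPos_sub_le y]⟩
  · refine ⟨fun x => _root_.laxOleinik c (fun z => _root_.laxOleinikPos c u z - C) x + C,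
      (continuous_laxOleinik hc (hp.bounded hcb)).add continuous_const, hp.laxOleinik hcb, ?_⟩
    have h₁ := laxOleinik_le hcb (hp.bounded hcb) x y
    have h₂ : u x - C ≤ _root_.laxOleinik c (fun z => _root_.laxOleinikPos c u z - C) x :=
      le_laxOleinik fun z => by linarith [le_laxOleinikPos hcb (hu.bounded hcb) z x]
    simp only
    linarith

theorem exists_continuous_isStrictSubsolution [SecondCountableTopology X]
    (hc : Continuous fun p : X × X => c p.1 p.2) (hu : ∃ u, IsSubsolution c C u) :
    ∃ v, Continuous v ∧ IsStrictSubsolution c C v := by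
  obtain ⟨B, hB⟩ := exists_abs_le_of_continuous_cost hc
  have x₀ : X := Classical.arbitrary X
  -- Normalizing at `x₀` bounds all members by the same constant, so the weighted series below
  -- converges uniformly.
  let I := {v : X → ℝ // Continuous v ∧ IsSubsolution c C v ∧ v x₀ = 0}
  have hI : ∀ v : I, ∀ x, |v.1 x| ≤ B + C := fun v x => by
    have h₁ := v.2.2.1 x x₀
    have h₂ := v.2.2.1 x₀ x
    rw [v.2.2.2] at h₁ h₂
    rw [abs_le]
    constructor <;> linarith [le_of_abs_le (hB x x₀), le_of_abs_le (hB x₀ x)]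
  have hnorm : ∀ v, Continuous v → IsSubsolution c C v →
      ∃ w : I, ∀ x y, w.1 y - w.1 x = v y - v x := fun v hv hv' =>
    ⟨⟨fun x => v x - v x₀, hv.sub continuous_const, fun x y => by linarith [hv' x y],
      sub_self _⟩, fun x y => by simp⟩
  have hIne : Nonempty I := by
    obtain ⟨u, hu⟩ := hu
    obtain ⟨w, -⟩ := hnorm _ ((continuous_laxOleinik hc
      (hu.bounded ⟨B, hB⟩)).add continuous_const) (hu.laxOleinik ⟨B, hB⟩)
    exact ⟨w⟩
  let O : I → Set (X × X) := fun v => {p | v.1 p.2 - v.1 p.1 < c p.1 p.2 + C}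
  have hO : ∀ v, IsOpen (O v) := fun v =>
    isOpen_lt ((v.2.1.comp continuous_snd).sub (v.2.1.comp continuous_fst))
      (hc.add continuous_const)
  -- Lindelöf: countably many subsolutions already detect every pair at which some continuous
  -- subsolution is not an equality.
  obtain ⟨T, hT, hTO⟩ := TopologicalSpace.isOpen_iUnion_countable O hO
  obtain ⟨v₀⟩ := hIne
  obtain ⟨s, hs⟩ := (hT.insert v₀).exists_eq_range (insert_nonempty _ _)
  have hsum : ∀ x, Summable fun k : ℕ => (1 / 2 : ℝ) ^ k * ((s k).1 x) := fun x => by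
    refine Summable.of_norm_bounded (g := fun k : ℕ => (1 / 2 : ℝ) ^ k * (B + C))
      (summable_geometric_two.mul_right _) fun k => ?_
    rw [norm_mul, norm_pow, Real.norm_eq_abs, Real.norm_eq_abs]
    norm_num
    exact hI (s k) x
  -- The weights `2^{-k-1}` sum to one, so the gap of `w` is the weighted mean of the gaps and
  -- vanishes only where all of them do.
  let w : X → ℝ := fun x => (∑' k : ℕ, (1 / 2 : ℝ) ^ k * ((s k).1 x)) / 2
  have hgap : ∀ x y, HasSum (fun k : ℕ => (1 / 2 : ℝ) ^ k *
      (c x y + C - ((s k).1 y - (s k).1 x))) (2 * (c x y + C - (w y - w x))) := fun x y => by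
    have h := (hasSum_geometric_two.mul_right (c x y + C)).sub
      ((hsum y).hasSum.sub (hsum x).hasSum)
    have h₁ : (fun k : ℕ => (1 / 2 : ℝ) ^ k * (c x y + C - ((s k).1 y - (s k).1 x))) = fun k =>
        (1 / 2 : ℝ) ^ k * (c x y + C) -
          ((1 / 2 : ℝ) ^ k * (s k).1 y - (1 / 2 : ℝ) ^ k * (s k).1 x) := by
      funext k
      ring
    have hw : ∀ z, w z = (∑' k : ℕ, (1 / 2 : ℝ) ^ k * ((s k).1 z)) / 2 := fun z => rfl
    rw [h₁, hw x, hw y, show ∀ a b d : ℝ, 2 * (a - (b / 2 - d / 2)) = 2 * a - (b - d) by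
      intros; ring]
    exact h
  have hnn : ∀ x y, ∀ k : ℕ, 0 ≤ (1 / 2 : ℝ) ^ k * (c x y + C - ((s k).1 y - (s k).1 x)) :=
    fun x y k => mul_nonneg (by positivity) (by linarith [(s k).2.2.1 x y])
  refine ⟨w, ?_, fun x y => ?_, fun x y hxy u hu => ?_⟩
  · refine Continuous.div_const (continuous_tsum (u := fun k : ℕ => (1 / 2 : ℝ) ^ k * (B + C))
      (fun k => continuous_const.mul (s k).2.1) (summable_geometric_two.mul_right _)
      fun k x => ?_) 2
    change ‖(1 / 2 : ℝ) ^ k * (s k).1 x‖ ≤ _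
    rw [norm_mul, norm_pow, Real.norm_eq_abs, Real.norm_eq_abs]
    norm_num
    exact hI (s k) x
  · have := (hgap x y).nonneg (hnn x y)
    linarith
  · by_contra hne
    obtain ⟨v, hv, hv', hlt⟩ := hu.exists_continuous_lt hc (lt_of_le_of_ne (hu x y) hne)
    obtain ⟨v', hv'⟩ := hnorm v hv hv'
    have hmem : (x, y) ∈ ⋃ i, O i := mem_iUnion.2 ⟨v', by
      simp only [O, mem_ofPred_eq, hv']
      exact hlt⟩
    rw [← hTO] at hmem
    obtain ⟨i, hi, hxyi⟩ := mem_iUnion₂.1 hmem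
    obtain ⟨k, hk⟩ : i ∈ range s := hs ▸ mem_insert_of_mem _ hi
    have h0 := (hgap x y).tsum_eq
    have hpos := (hgap x y).summable.tsum_pos (hnn x y) k (by
      refine mul_pos (by positivity) ?_
      rw [hk]
      simp only [O, mem_ofPred_eq] at hxyi
      linarith)
    linarith

/-- `T⁻` is monotone and commutes with adding constants. Applied to `u' ≤ u + m` with `m = sup (u' -
u)`, this gives `m ≤ m + (C' - C)`. -/
theorem IsWeakKAMSolution.const_le {C' : ℝ} {u' : X → ℝ}
    (hc : Continuous fun p : X × X => c p.1 p.2)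
    (hu : IsWeakKAMSolution c C u) (hu' : IsWeakKAMSolution c C' u') : C ≤ C' := by
  have hcb := exists_abs_le_of_continuous_cost hc
  obtain ⟨hb, ha, he⟩ := hu
  obtain ⟨hb', ha', he'⟩ := hu'
  have hub : ∃ D, ∀ x, |u x| ≤ D := by
    obtain ⟨a, ha⟩ := ha
    obtain ⟨b, hb⟩ := hb
    exact ⟨max a (-b), fun x => abs_le'.2 ⟨le_max_of_le_left (ha ⟨x, rfl⟩),
      le_max_of_le_right (neg_le_neg (hb ⟨x, rfl⟩))⟩⟩
  have hub' : ∃ D, ∀ x, |u' x| ≤ D := by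
    obtain ⟨a, ha⟩ := ha'
    obtain ⟨b, hb⟩ := hb'
    exact ⟨max a (-b), fun x => abs_le'.2 ⟨le_max_of_le_left (ha ⟨x, rfl⟩),
      le_max_of_le_right (neg_le_neg (hb ⟨x, rfl⟩))⟩⟩
  have hbdd : BddAbove (range fun x => u' x - u x) := by
    obtain ⟨D, hD⟩ := hub
    obtain ⟨D', hD'⟩ := hub'
    refine ⟨D' + D, ?_⟩
    rintro _ ⟨x, rfl⟩
    simp only
    linarith [le_of_abs_le (hD' x), neg_le_of_abs_le (hD x)]
  set m := ⨆ x, u' x - u x with hm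
  have hle : ∀ x, u' x - u x ≤ m := fun x => le_ciSup hbdd x
  have hmle : m ≤ m + (C' - C) := ciSup_le fun x => by
    have h₁ : laxOleinik c u' x - m ≤ laxOleinik c u x := le_laxOleinik fun y => by
      linarith [laxOleinik_le hcb hub' y x, hle y]
    rw [he x, he' x]
    linarith
  linarith

/-- The least constant admitting subsolutions is the critical value. -/
theorem isCriticalValue_of_isLeast [SecondCountableTopology X]
    (hc : Continuous fun p : X × X => c p.1 p.2)
    (hC : IsLeast {C | ∃ u, IsSubsolution c C u} C) : IsCriticalValue c C := by
  have hcb := exists_abs_le_of_continuous_cost hc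
  suffices h : ∃ u, IsWeakKAMSolution c C u by
    refine ⟨h, fun C' ⟨u', hu'⟩ => ?_⟩
    obtain ⟨u, hu⟩ := h
    exact le_antisymm (hu'.const_le hc hu) (hu.const_le hc hu')
  obtain ⟨v, hvc, hv, hvs⟩ := exists_continuous_isStrictSubsolution hc hC.1
  -- Otherwise the gap of `v` has a positive minimum by compactness, and `v` is a subsolution for a
  -- constant below the least one.
  obtain ⟨x, y, hxy⟩ : ∃ x y, v y - v x = c x y + C := by
    have hcont : Continuous fun p : X × X => c p.1 p.2 + C - (v p.2 - v p.1) := by fun_prop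
    obtain ⟨⟨x, y⟩, -, hmin⟩ := isCompact_univ.exists_isMinOn univ_nonempty hcont.continuousOn
    refine ⟨x, y, le_antisymm (hv x y) ?_⟩
    have hsub : IsSubsolution c (C - (c x y + C - (v y - v x))) v := fun a b => by
      have := hmin (mem_univ (a, b))
      simp only [mem_ofPred_eq] at this
      linarith
    linarith [hC.2 ⟨v, hsub⟩]
  have hall := hvs x y hxy
  have hbd : ∀ z, BddAbove {a | ∃ w, IsSubsolution c C w ∧ w y = 0 ∧ w z = a} := fun z => by
    refine ⟨c y z + C, ?_⟩
    rintro _ ⟨w, hw, hwy, rfl⟩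
    linarith [hw y z]
  -- The maximal subsolution vanishing at `y`. Since `T⁻ V + C` is again a subsolution, it equals
  -- `V` as soon as it also vanishes at `y`; that follows from equality at `(x, y)`, which every
  -- subsolution satisfies.
  let V : X → ℝ := fun z => sSup {a | ∃ w, IsSubsolution c C w ∧ w y = 0 ∧ w z = a}
  have hVle : ∀ w, IsSubsolution c C w → w y = 0 → ∀ z, w z ≤ V z := fun w hw hwy z =>
    le_csSup (hbd z) ⟨w, hw, hwy, rfl⟩
  have hleV : ∀ z a, (∀ w, IsSubsolution c C w → w y = 0 → w z ≤ a) → V z ≤ a := fun z a h => by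
    refine csSup_le ⟨v z - v y, fun z => v z - v y, fun a b => by linarith [hv a b],
      sub_self _, rfl⟩ ?_
    rintro _ ⟨w, hw, hwy, rfl⟩
    exact h w hw hwy
  have hV : IsSubsolution c C V := fun a b => by
    have := hleV b (V a + c a b + C) fun w hw hwy => by linarith [hw a b, hVle w hw hwy a]
    linarith
  have hVy : V y = 0 := le_antisymm (hleV y 0 fun w _ hwy => hwy.le) (by
    have := hVle (fun z => v z - v y) (fun a b => by linarith [hv a b]) (sub_self _) y
    simpa using this)
  have hTy : laxOleinik c V y + C = 0 := by
    refine le_antisymm ?_ (by rw [← hVy]; exact hV.le_laxOleinik_add y)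
    have h₁ := laxOleinik_le hcb (hV.bounded hcb) x y
    have h₂ := hall V hV
    linarith
  obtain ⟨D, hD⟩ := hV.bounded hcb
  refine ⟨V, ⟨-D, ?_⟩, ⟨D, ?_⟩, fun z => le_antisymm (hV.le_laxOleinik_add z)
    (hVle _ (hV.laxOleinik hcb) hTy z)⟩
  · rintro _ ⟨z, rfl⟩
    exact neg_le_of_abs_le (hD z)
  · rintro _ ⟨z, rfl⟩
    exact le_of_abs_le (hD z)

end Compact

end WeakKAM

/-! ### Insertion of a `C^{1,1}` function in Euclidean space. -/

section Insertion

open Set Filter Topology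

theorem convexOn_univ_of_continuous_of_midpoint {E : Type*} [AddCommGroup E] [Module ℝ E]
    [TopologicalSpace E] [ContinuousAdd E] [ContinuousSMul ℝ E] {F : E → ℝ} (hF : Continuous F)
    (h : ∀ z v, 2 * F z ≤ F (z + v) + F (z - v)) : ConvexOn ℝ univ F := by
  refine ⟨convex_univ, fun x _ y _ a b ha hb hab => ?_⟩
  let φ : ℝ → ℝ := fun t => F (x + t • (y - x)) - ((1 - t) * F x + t * F y)
  have hφ : Continuous φ := by
    have : Continuous fun t : ℝ => x + t • (y - x) :=
      continuous_const.add (continuous_id.smul continuous_const)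
    exact (hF.comp this).sub (by fun_prop)
  have hmid : ∀ t d, 2 * φ t ≤ φ (t + d) + φ (t - d) := fun t d => by
    have := h (x + t • (y - x)) (d • (y - x))
    have e₁ : x + t • (y - x) + d • (y - x) = x + (t + d) • (y - x) := by module
    have e₂ : x + t • (y - x) - d • (y - x) = x + (t - d) • (y - x) := by module
    rw [e₁, e₂] at this
    simp only [φ]
    linarith
  have h0 : φ 0 = 0 := by simp [φ]
  have h1 : φ 1 = 0 := by simp [φ]
  suffices hle : ∀ t ∈ Icc (0 : ℝ) 1, φ t ≤ 0 by
    have := hle b ⟨hb, by linarith⟩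
    obtain rfl : a = 1 - b := by linarith
    have e : x + b • (y - x) = (1 - b) • x + b • y := by module
    simp only [φ, e] at this
    simp only [smul_eq_mul]
    linarith
  by_contra! hcon
  obtain ⟨t₁, ht₁, hpos⟩ := hcon
  obtain ⟨t₂, ht₂, hmax⟩ := isCompact_Icc.exists_isMaxOn ⟨t₁, ht₁⟩ hφ.continuousOn
  have hcomp : IsCompact (Icc (0 : ℝ) 1 ∩ {t | φ t = φ t₂}) :=
    isCompact_Icc.inter_right (isClosed_eq hφ continuous_const)
  -- Leftmost maximizer of the deviation from the chord: a point to its left is strictly lower,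
  -- which contradicts the midpoint inequality.
  obtain ⟨t, ⟨ht, hteq⟩, hmin⟩ := hcomp.exists_isLeast ⟨t₂, ht₂, rfl⟩
  replace hteq : φ t = φ t₂ := hteq
  have hM : 0 < φ t := hteq ▸ hpos.trans_le (hmax ht₁)
  have htlo : 0 < t := lt_of_le_of_ne ht.1 (by rintro rfl; linarith)
  have hthi : t < 1 := lt_of_le_of_ne ht.2 (by rintro rfl; linarith)
  set d := min t (1 - t) with hd
  have hd0 : 0 < d := lt_min htlo (by linarith)
  have hdt : d ≤ t := min_le_left _ _
  have hdt' : d ≤ 1 - t := min_le_right _ _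
  have hplus : φ (t + d) ≤ φ t := hteq ▸ hmax (show t + d ∈ Icc (0 : ℝ) 1 from
    ⟨by linarith, by linarith⟩)
  have hmem : t - d ∈ Icc (0 : ℝ) 1 := ⟨by linarith, by linarith⟩
  have hminus : φ (t - d) < φ t := lt_of_le_of_ne (hteq ▸ hmax hmem) fun he => by
    have := hmin ⟨hmem, he.trans hteq⟩
    linarith
  linarith [hmid t d]

theorem ConvexOn.exists_subgradient {E : Type*} [NormedAddCommGroup E] [NormedSpace ℝ E]
    [FiniteDimensional ℝ E] {W : E → ℝ} (hW : ConvexOn ℝ univ W) (x : E) :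
    ∃ p : E →L[ℝ] ℝ, ∀ z, W x + p (z - x) ≤ W z := by
  have hcont : Continuous W := hW.locallyLipschitz.continuous
  have hopen : IsOpen {q : E × ℝ | q.1 ∈ univ ∧ W q.1 < q.2} := by
    simpa using isOpen_lt (hcont.comp continuous_fst) continuous_snd
  obtain ⟨f, hf⟩ := geometric_hahn_banach_open_point hW.convex_strict_epigraph hopen
    (x := (x, W x)) (by simp)
  have hsplit : ∀ z t, f (z, t) = f (z, 0) + t * f (0, 1) := fun z t => by
    have : ((z, t) : E × ℝ) = (z, 0) + t • (0, 1) := by simp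
    rw [this, map_add, map_smul, smul_eq_mul]
  set s := f (0, 1) with hs
  -- The separating hyperplane is not vertical, so it is the graph of an affine function; dividing
  -- by `-s` yields its slope.
  have hsneg : s < 0 := by
    have := hf (x, W x + 1) ⟨mem_univ _, by simp⟩
    rw [hsplit x (W x + 1), hsplit x (W x)] at this
    linarith
  refine ⟨(-s)⁻¹ • f.comp (ContinuousLinearMap.inl ℝ E ℝ), fun z => ?_⟩
  refine le_of_forall_gt_imp_ge_of_dense fun t ht => ?_
  have := hf (z, t) ⟨mem_univ _, ht⟩
  rw [hsplit z t, hsplit x (W x)] at this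
  have hsub : f (z - x, 0) = f (z, 0) - f (x, 0) := by
    rw [← map_sub]
    simp
  have hval : ((-s)⁻¹ • f.comp (ContinuousLinearMap.inl ℝ E ℝ)) (z - x) =
      (-s)⁻¹ * (f (z, 0) - f (x, 0)) := by
    simp [← hsub]
  rw [hval]
  have hle : (-s)⁻¹ * (f (z, 0) - f (x, 0)) ≤ (-s)⁻¹ * ((-s) * (t - W x)) :=
    mul_le_mul_of_nonneg_left (by linarith) (inv_nonneg.2 (by linarith))
  rw [inv_mul_cancel_left₀ (by linarith : -s ≠ 0)] at hle
  linarith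

section Quadratic

variable {E : Type*} [NormedAddCommGroup E] [NormedSpace ℝ E]

theorem hasFDerivAt_of_quadratic_bound {w : E → ℝ} {p : E →L[ℝ] ℝ} {K : ℝ} {x : E}
    (h : ∀ v, |w (x + v) - w x - p v| ≤ K * ‖v‖ ^ 2) : HasFDerivAt w p x := by
  rw [hasFDerivAt_iff_isLittleO_nhds_zero]
  have h₁ : (fun v => w (x + v) - w x - p v) =O[𝓝 0] fun v : E => ‖v‖ ^ 2 :=
    Asymptotics.IsBigO.of_bound K (Eventually.of_forall fun v => by
      simpa using h v)
  refine h₁.trans_isLittleO ?_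
  exact (Asymptotics.isLittleO_norm_pow_id one_lt_two)

/-- Test `p y - p x` on vectors of length `r = ‖y - x‖`: going from `x` to `y + r • e` directly or
through `y` costs errors `4 K r²`, `K r²` and `K r²`, whence the `6`. -/
theorem lipschitzWith_of_quadratic_bound {w : E → ℝ} {p : E → E →L[ℝ] ℝ} {K : ℝ} (hK : 0 ≤ K)
    (h : ∀ x v, |w (x + v) - w x - p x v| ≤ K * ‖v‖ ^ 2) :
    LipschitzWith (Real.toNNReal (6 * K)) p := by
  refine LipschitzWith.of_dist_le_mul fun y x => ?_
  rw [Real.coe_toNNReal _ (by positivity), dist_eq_norm, dist_eq_norm]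
  set r := ‖y - x‖ with hr
  rcases eq_or_ne y x with rfl | hne
  · simp [hr]
  have hr0 : 0 < r := norm_pos_iff.2 (sub_ne_zero.2 hne)
  refine ContinuousLinearMap.opNorm_le_of_unit_norm (by positivity) fun e he => ?_
  have hv : ‖r • e‖ = r := by rw [norm_smul, he, Real.norm_eq_abs, abs_of_pos hr0, mul_one]
  have hA := h x (y - x + r • e)
  have hB := h x (y - x)
  have hC := h y (r • e)
  have hn : ‖y - x + r • e‖ ≤ 2 * r := (norm_add_le _ _).trans (by rw [hv]; linarith)
  have hn2 : K * ‖y - x + r • e‖ ^ 2 ≤ K * (2 * r) ^ 2 := by gcongr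
  have e₁ : x + (y - x + r • e) = y + r • e := by abel
  have e₂ : x + (y - x) = y := by abel
  rw [e₁, map_add] at hA
  rw [e₂, ← hr] at hB
  rw [hv] at hC
  have hle : |(p y - p x) (r • e)| ≤ 6 * K * r ^ 2 := by
    rw [sub_apply]
    rw [abs_le] at hA hB hC ⊢
    constructor <;> linarith [hA.1, hA.2, hB.1, hB.2, hC.1, hC.2]
  rw [map_smul, smul_eq_mul, abs_mul, abs_of_pos hr0] at hle
  rw [Real.norm_eq_abs]
  have : r * |(p y - p x) e| ≤ r * (6 * K * r) := by linarith [hle]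
  exact le_of_mul_le_mul_left this hr0

end Quadratic

section InnerProduct

variable {E : Type*} [NormedAddCommGroup E] [InnerProductSpace ℝ E]

theorem norm_sq_add_add_norm_sq_sub (z v : E) :
    ‖z + v‖ ^ 2 + ‖z - v‖ ^ 2 = 2 * ‖z‖ ^ 2 + 2 * ‖v‖ ^ 2 := by
  have := parallelogram_law_with_norm ℝ z v
  nlinarith

variable [FiniteDimensional ℝ E]

/-- Insertion of a `C^{1,1}` function between a semiconvex and a semiconcave function, staying
strictly above the lower one: subtract a quadratic function from the convex envelope of
`G + K ‖·‖²`. -/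
theorem exists_quadratic_bound_between_of_lt {F G : E → ℝ} (hF : Continuous F) (hG : Continuous G)
    (hFG : ∀ z, F z ≤ G z) {K : ℝ} (hK : 0 < K)
    (hF₂ : ∀ z v, 2 * F z - K * ‖v‖ ^ 2 ≤ F (z + v) + F (z - v))
    (hG₂ : ∀ z v, G (z + v) + G (z - v) ≤ 2 * G z + K * ‖v‖ ^ 2) :
    ∃ w : E → ℝ, (∀ z, F z ≤ w z) ∧ (∀ z, w z ≤ G z) ∧ (∀ z, F z < G z → F z < w z) ∧
      ∃ p : E → E →L[ℝ] ℝ, ∀ x v, |w (x + v) - w x - p x v| ≤ 3 * K * ‖v‖ ^ 2 := by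
  let H : E → ℝ := fun z => G z + K * ‖z‖ ^ 2
  let S := {φ : E → ℝ // ConvexOn ℝ univ φ ∧ ∀ z, φ z ≤ H z}
  have hFconv : ConvexOn ℝ univ fun z => F z + K / 2 * ‖z‖ ^ 2 :=
    convexOn_univ_of_continuous_of_midpoint (by fun_prop) fun z v => by
      have := hF₂ z v
      have := norm_sq_add_add_norm_sq_sub z v
      nlinarith
  have hsq : ConvexOn ℝ univ fun z : E => K / 2 * ‖z‖ ^ 2 :=
    convexOn_univ_of_continuous_of_midpoint (by fun_prop) fun z v => by
      have := norm_sq_add_add_norm_sq_sub z v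
      nlinarith [mul_nonneg hK.le (sq_nonneg ‖v‖)]
  -- Only `K / 2` is needed to make `F` convex; the other half is slack, spent below on strictness.
  let φ₀ : S := ⟨fun z => F z + K / 2 * ‖z‖ ^ 2 + K / 2 * ‖z‖ ^ 2, hFconv.add hsq, fun z => by
    simp only [H]
    linarith [hFG z]⟩
  have : Nonempty S := ⟨φ₀⟩
  let W : E → ℝ := fun z => ⨆ φ : S, φ.1 z
  have hbdd : ∀ z, BddAbove (range fun φ : S => φ.1 z) := fun z => by
    refine ⟨H z, ?_⟩
    rintro _ ⟨φ, rfl⟩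
    exact φ.2.2 z
  have hle : ∀ (φ : S) z, φ.1 z ≤ W z := fun φ z => le_ciSup (hbdd z) φ
  have hWH : ∀ z, W z ≤ H z := fun z => ciSup_le fun φ => φ.2.2 z
  have hWconv : ConvexOn ℝ univ W := by
    refine ⟨convex_univ, fun x hx y hy a b ha hb hab => ciSup_le fun φ => ?_⟩
    refine (φ.2.1.2 hx hy ha hb hab).trans ?_
    simp only [smul_eq_mul]
    have := mul_le_mul_of_nonneg_left (hle φ x) ha
    have := mul_le_mul_of_nonneg_left (hle φ y) hb
    linarith
  have hWsc : ∀ z v, W (z + v) + W (z - v) ≤ 2 * W z + 3 * K * ‖v‖ ^ 2 := fun z v => by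
    -- The average of two translates of `W`, lowered by `3 K / 2 * ‖v‖²`, is a convex minorant of
    -- `H`, hence lies below the envelope: this is semiconcavity of `W`.
    have hmem : ConvexOn ℝ univ fun y =>
        (1 / 2 : ℝ) * (W (v + y) + W (-v + y)) + -(3 * K / 2 * ‖v‖ ^ 2) := by
      have h₁ : ConvexOn ℝ univ fun y => W (v + y) := by
        simpa [Function.comp_def] using hWconv.translate_right v
      have h₂ : ConvexOn ℝ univ fun y => W (-v + y) := by
        simpa [Function.comp_def] using hWconv.translate_right (-v)
      exact ((h₁.add h₂).smul (by norm_num : (0 : ℝ) ≤ 1 / 2)).add_const _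
    have := hle ⟨_, hmem, fun y => by
      have h₁ := hWH (v + y)
      have h₂ := hWH (-v + y)
      have h₃ := hG₂ y v
      have h₄ := norm_sq_add_add_norm_sq_sub y v
      rw [show v + y = y + v by abel] at h₁ ⊢
      rw [show -v + y = y - v by abel] at h₂ ⊢
      simp only [H] at h₁ h₂ ⊢
      have h₅ := congrArg (K * ·) h₄
      beta_reduce at h₅
      linarith⟩ z
    simp only at this
    rw [show v + z = z + v by abel, show -v + z = z - v by abel] at this
    linarith
  refine ⟨fun z => W z - K * ‖z‖ ^ 2, fun z => ?_, fun z => ?_, fun x₀ hlt => ?_, ?_⟩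
  · have := hle φ₀ z
    simp only [φ₀] at this
    linarith
  · have := hWH z
    simp only [H] at this
    linarith
  · have hev : ∀ᶠ z in 𝓝 x₀, F z + (G x₀ - F x₀) / 2 < G z :=
      (hF.add continuous_const).continuousAt.eventually_lt hG.continuousAt (by
        simp only [Pi.add_apply]
        linarith)
    obtain ⟨r, hr, hball⟩ := Metric.eventually_nhds_iff.1 hev
    -- Competitor at `x₀`: replace the spare `K / 2 * ‖z‖²` by its tangent at `x₀` raised by `ε`.
    -- Near `x₀` the gap `G - F` absorbs `ε`; at distance at least `r` the loss `K / 2 * ‖z - x₀‖²`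
    -- does.
    set ε := min ((G x₀ - F x₀) / 2) (K / 2 * r ^ 2) with hε
    have hε0 : 0 < ε := lt_min (by linarith) (by positivity)
    have hε₁ : ε ≤ (G x₀ - F x₀) / 2 := min_le_left _ _
    have hε₂ : ε ≤ K / 2 * r ^ 2 := min_le_right _ _
    have haff : ConvexOn ℝ univ fun z => K * inner ℝ x₀ z + (ε - K / 2 * ‖x₀‖ ^ 2) := by
      refine ⟨convex_univ, fun x _ y _ a b _ _ hab => le_of_eq ?_⟩
      obtain rfl : a = 1 - b := by linarith
      simp only [inner_add_right, inner_smul_right, smul_eq_mul]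
      ring
    have hexp : ∀ z, F z + K / 2 * ‖z‖ ^ 2 + (K * inner ℝ x₀ z + (ε - K / 2 * ‖x₀‖ ^ 2)) =
        F z + K * ‖z‖ ^ 2 - K / 2 * ‖z - x₀‖ ^ 2 + ε := fun z => by
      rw [norm_sub_sq_real, real_inner_comm]
      ring
    have := hle ⟨_, hFconv.add haff, fun z => by
      simp only [Pi.add_apply, H]
      rw [hexp]
      rcases lt_or_ge (dist z x₀) r with hz | hz
      · have := hball hz
        have : 0 ≤ K / 2 * ‖z - x₀‖ ^ 2 := by positivity
        linarith
      · rw [dist_eq_norm] at hz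
        have : K / 2 * r ^ 2 ≤ K / 2 * ‖z - x₀‖ ^ 2 := by gcongr
        linarith [hFG z]⟩ x₀
    simp only [Pi.add_apply] at this
    rw [hexp, sub_self, norm_zero] at this
    nlinarith
  · choose p hp using hWconv.exists_subgradient
    refine ⟨fun x => p x - (2 * K) • innerSL ℝ x, fun x v => ?_⟩
    have h₁ := hp x (x + v)
    have h₂ := hp x (x - v)
    have h₃ := hWsc x v
    have h₄ : ‖x + v‖ ^ 2 = ‖x‖ ^ 2 + 2 * inner ℝ x v + ‖v‖ ^ 2 := norm_add_sq_real x v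
    rw [add_sub_cancel_left] at h₁
    rw [sub_sub_cancel_left, map_neg] at h₂
    have h₅ : (p x - (2 * K) • innerSL ℝ x) v = p x v - 2 * K * inner ℝ x v := by simp
    have h₆ : 0 ≤ K * ‖v‖ ^ 2 := by positivity
    simp only
    rw [h₅, h₄, abs_le]
    constructor <;> linarith

/-- Insertion of a `C^{1,1}` function strictly between a semiconvex and a semiconcave function. -/
theorem exists_quadratic_bound_between {F G : E → ℝ} (hF : Continuous F) (hG : Continuous G)
    (hFG : ∀ z, F z ≤ G z) {K : ℝ} (hK : 0 < K)
    (hF₂ : ∀ z v, 2 * F z - K * ‖v‖ ^ 2 ≤ F (z + v) + F (z - v))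
    (hG₂ : ∀ z v, G (z + v) + G (z - v) ≤ 2 * G z + K * ‖v‖ ^ 2) :
    ∃ w : E → ℝ, (∀ z, F z ≤ w z) ∧ (∀ z, w z ≤ G z) ∧
      (∀ z, F z < G z → F z < w z ∧ w z < G z) ∧
      ∃ p : E → E →L[ℝ] ℝ, (∀ z, HasFDerivAt w (p z) z) ∧
        LipschitzWith (Real.toNNReal (6 * (3 * K))) p := by
  obtain ⟨w₁, hF₁, hG₁, hlt₁, p₁, hp₁⟩ :=
    exists_quadratic_bound_between_of_lt hF hG hFG hK hF₂ hG₂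
  -- Mirror image: `-w₂` lies between `F` and `G` and is strictly below `G` where `F < G`, so its
  -- mean with `w₁` is strict on both sides.
  obtain ⟨w₂, hF₃, hG₃, hlt₂, p₂, hp₂⟩ :=
    exists_quadratic_bound_between_of_lt hG.neg hF.neg (fun z => neg_le_neg (hFG z)) hK
      (fun z v => by simp only [Pi.neg_apply]; linarith [hG₂ z v])
      (fun z v => by simp only [Pi.neg_apply]; linarith [hF₂ z v])
  simp only [Pi.neg_apply] at hF₃ hG₃ hlt₂
  have hb : ∀ x v, |(w₁ (x + v) - w₂ (x + v)) / 2 - (w₁ x - w₂ x) / 2 -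
      ((1 / 2 : ℝ) • (p₁ x - p₂ x)) v| ≤ 3 * K * ‖v‖ ^ 2 := fun x v => by
    have e : ((1 / 2 : ℝ) • (p₁ x - p₂ x)) v = (p₁ x v - p₂ x v) / 2 := by
      simp
      ring
    have h₁ := hp₁ x v
    have h₂ := hp₂ x v
    rw [e]
    rw [abs_le] at *
    constructor <;> linarith
  refine ⟨fun z => (w₁ z - w₂ z) / 2, fun z => by linarith [hF₁ z, hG₃ z],
    fun z => by linarith [hG₁ z, hF₃ z], fun z hz => ?_, fun z => (1 / 2 : ℝ) • (p₁ z - p₂ z),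
    fun z => hasFDerivAt_of_quadratic_bound (hb z),
    lipschitzWith_of_quadratic_bound (w := fun z => (w₁ z - w₂ z) / 2) (by positivity) hb⟩
  have h₁ := hlt₁ z hz
  have h₂ := hlt₂ z (neg_lt_neg hz)
  constructor <;> linarith [hF₁ z, hG₃ z, hG₁ z, hF₃ z]

end InnerProduct

end Insertion

/-! ### Local `C^{1,1}` regularity and semiconcavity: changes of variables and cutoffs. -/

section LocalRegularity

open Set Filter Topology Metric

/-- `f` is Lipschitz on some neighbourhood of `a`. -/
def LipschitzNear {X Y : Type*} [PseudoEMetricSpace X] [PseudoEMetricSpace Y] (f : X → Y)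
    (a : X) : Prop :=
  ∃ K, ∃ s ∈ 𝓝 a, LipschitzOnWith K f s

section LipschitzNear

variable {X Y Z : Type*} [PseudoEMetricSpace X] [PseudoEMetricSpace Y] [PseudoEMetricSpace Z]

theorem LipschitzNear.continuousAt {f : X → Y} {a : X} (hf : LipschitzNear f a) :
    ContinuousAt f a := by
  obtain ⟨K, s, hs, hK⟩ := hf
  exact hK.continuousOn.continuousAt hs

theorem LipschitzNear.comp {g : Y → Z} {f : X → Y} {a : X} (hg : LipschitzNear g (f a))
    (hf : LipschitzNear f a) : LipschitzNear (fun x => g (f x)) a := by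
  have hc := hf.continuousAt
  obtain ⟨K, s, hs, hK⟩ := hf
  obtain ⟨L, t, ht, hL⟩ := hg
  exact ⟨L * K, s ∩ f ⁻¹' t, inter_mem hs (hc.preimage_mem_nhds ht),
    hL.comp (hK.mono inter_subset_left) fun x hx => hx.2⟩

theorem LipschitzNear.prodMk {f : X → Y} {g : X → Z} {a : X} (hf : LipschitzNear f a)
    (hg : LipschitzNear g a) : LipschitzNear (fun x => (f x, g x)) a := by
  obtain ⟨K, s, hs, hK⟩ := hf
  obtain ⟨L, t, ht, hL⟩ := hg
  exact ⟨max K L, s ∩ t, inter_mem hs ht,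
    (hK.mono inter_subset_left).prodMk (hL.mono inter_subset_right)⟩

theorem LipschitzNear.congr {f g : X → Y} {a : X} (hf : LipschitzNear f a)
    (h : f =ᶠ[𝓝 a] g) : LipschitzNear g a := by
  obtain ⟨K, s, hs, hK⟩ := hf
  refine ⟨K, s ∩ {x | f x = g x}, inter_mem hs h, fun x hx y hy => ?_⟩
  rw [← hx.2, ← hy.2]
  exact hK hx.1 hy.1

end LipschitzNear

variable {E : Type*} [NormedAddCommGroup E] [NormedSpace ℝ E]
variable {E' : Type*} [NormedAddCommGroup E'] [NormedSpace ℝ E']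

theorem ContDiffAt.lipschitzNear {f : E → E'} {a : E} (hf : ContDiffAt ℝ 1 f a) :
    LipschitzNear f a :=
  hf.exists_lipschitzOnWith

/-- `h` is differentiable near `a` with Lipschitz differential. -/
def IsC11At (h : E → ℝ) (a : E) : Prop :=
  (∀ᶠ z in 𝓝 a, DifferentiableAt ℝ h z) ∧ LipschitzNear (fderiv ℝ h) a

theorem IsC11At.congr {h k : E → ℝ} {a : E} (hh : IsC11At h a) (hk : h =ᶠ[𝓝 a] k) :
    IsC11At k a := by
  refine ⟨?_, hh.2.congr hk.fderiv⟩
  filter_upwards [hh.1, hk.eventuallyEq_nhds] with z hz hzk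
  exact hz.congr_of_eventuallyEq hzk.symm

theorem isC11At_const (b : ℝ) (a : E) : IsC11At (fun _ : E => b) a := by
  refine ⟨Eventually.of_forall fun z => by fun_prop, 0, univ, univ_mem, ?_⟩
  rw [fderiv_fun_const]
  exact fun x _ y _ => by simp

theorem IsC11At.add {h k : E → ℝ} {a : E} (hh : IsC11At h a) (hk : IsC11At k a) :
    IsC11At (fun z => h z + k z) a := by
  refine ⟨hh.1.and hk.1 |>.mono fun z hz => hz.1.add hz.2, ?_⟩
  have hadd : LipschitzNear (fun q : (E →L[ℝ] ℝ) × (E →L[ℝ] ℝ) => q.1 + q.2)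
      (fderiv ℝ h a, fderiv ℝ k a) :=
    (contDiff_fst.add contDiff_snd).contDiffAt.lipschitzNear
  refine (LipschitzNear.comp (f := fun z => (fderiv ℝ h z, fderiv ℝ k z)) hadd
    (hh.2.prodMk hk.2)).congr ?_
  filter_upwards [hh.1, hk.1] with z hz hz'
  exact (fderiv_fun_add hz hz').symm

theorem IsC11At.comp {h : E' → ℝ} {θ : E → E'} {a : E} (hh : IsC11At h (θ a))
    (hθ : ContDiffAt ℝ 2 θ a) : IsC11At (fun z => h (θ z)) a := by
  have hev := hθ.eventually (by simp)
  have hdiff : ∀ᶠ z in 𝓝 a, DifferentiableAt ℝ h (θ z) ∧ DifferentiableAt ℝ θ z := by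
    filter_upwards [hθ.continuousAt.eventually hh.1, hev] with z hz hz'
    exact ⟨hz, hz'.differentiableAt (by simp)⟩
  refine ⟨hdiff.mono fun z hz => hz.1.comp z hz.2, ?_⟩
  have hθ' : LipschitzNear (fderiv ℝ θ) a :=
    (hθ.fderiv_right (m := 1) (by norm_num)).lipschitzNear
  have hcomp : LipschitzNear (fun q : (E' →L[ℝ] ℝ) × (E →L[ℝ] E') => q.1.comp q.2)
      (fderiv ℝ h (θ a), fderiv ℝ θ a) :=
    (contDiff_fst.clm_comp contDiff_snd).contDiffAt.lipschitzNear
  refine (LipschitzNear.comp (f := fun z => (fderiv ℝ h (θ z), fderiv ℝ θ z)) hcomp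
    ((hh.2.comp (hθ.of_le (by norm_num)).lipschitzNear).prodMk hθ')).congr ?_
  filter_upwards [hdiff] with z hz
  exact (fderiv_comp z hz.1 hz.2).symm

theorem IsC11At.contDiffAt {h : E → ℝ} {a : E} (hh : IsC11At h a) : ContDiffAt ℝ 1 h a := by
  obtain ⟨hd, K, s, hs, hK⟩ := hh
  rw [contDiffAt_one_iff]
  exact ⟨fderiv ℝ h, _, inter_mem hs hd, hK.continuousOn.mono inter_subset_left,
    fun z hz => DifferentiableAt.hasFDerivAt hz.2⟩

theorem mem_ball_of_add_of_sub {a z v : E} {r : ℝ} (h₁ : z + v ∈ ball a r)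
    (h₂ : z - v ∈ ball a r) : z ∈ ball a r := by
  have := (convex_ball a r).midpoint_mem h₁ h₂
  rwa [midpoint_eq_smul_add, show z + v + (z - v) = (2 : ℝ) • z by module, smul_smul,
    show (⅟2 : ℝ) * 2 = 1 by norm_num, one_smul] at this

/-- First-order Taylor expansions at `z` in the directions `v` and `-v`: the linear terms cancel. -/
theorem Convex.norm_second_difference_le {θ : E → E'} {s : Set E} (hs : Convex ℝ s) {L : NNReal}
    (hd : ∀ z ∈ s, DifferentiableAt ℝ θ z) (hL : LipschitzOnWith L (fderiv ℝ θ) s) {z v : E}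
    (hz : z ∈ s) (hz₁ : z + v ∈ s) (hz₂ : z - v ∈ s) :
    ‖θ (z + v) + θ (z - v) - (2 : ℝ) • θ z‖ ≤ 2 * L * ‖v‖ ^ 2 := by
  have key : ∀ y ∈ s, ‖θ y - θ z - fderiv ℝ θ z (y - z)‖ ≤ L * ‖y - z‖ * ‖y - z‖ := by
    intro y hy
    have hseg : segment ℝ z y ⊆ s := hs.segment_subset hz hy
    refine (convex_segment z y).norm_image_sub_le_of_norm_fderiv_le' (f := θ)
      (fun x hx => hd x (hseg hx)) (fun x hx => ?_) (left_mem_segment ℝ z y)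
      (right_mem_segment ℝ z y)
    have := hL.dist_le_mul x (hseg hx) z hz
    rw [dist_eq_norm, dist_eq_norm] at this
    exact this.trans (mul_le_mul_of_nonneg_left (norm_sub_le_of_mem_segment hx) L.2)
  have h₁ := key _ hz₁
  have h₂ := key _ hz₂
  rw [add_sub_cancel_left] at h₁
  rw [sub_sub_cancel_left, map_neg, norm_neg] at h₂
  have e : θ (z + v) + θ (z - v) - (2 : ℝ) • θ z =
      (θ (z + v) - θ z - fderiv ℝ θ z v) + (θ (z - v) - θ z - -fderiv ℝ θ z v) := by module
  rw [e]
  refine (norm_add_le _ _).trans ?_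
  linarith

/-- Second order control of a `C²` map near a point. -/
theorem ContDiffAt.exists_second_difference_le {θ : E → E'} {a : E} (hθ : ContDiffAt ℝ 2 θ a) :
    ∃ r > 0, ∃ K ≥ 0, (∀ x ∈ ball a r, ∀ y ∈ ball a r, ‖θ x - θ y‖ ≤ K * ‖x - y‖) ∧
      ∀ z v, z + v ∈ ball a r → z - v ∈ ball a r →
        ‖θ (z + v) + θ (z - v) - (2 : ℝ) • θ z‖ ≤ K * ‖v‖ ^ 2 := by
  obtain ⟨K, s, hs, hK⟩ := (hθ.of_le (by norm_num : (1 : WithTop ℕ∞) ≤ 2)).lipschitzNear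
  obtain ⟨L, t, ht, hL⟩ := (hθ.fderiv_right (m := 1) (by norm_num)).lipschitzNear
  have hd : ∀ᶠ z in 𝓝 a, DifferentiableAt ℝ θ z := by
    filter_upwards [hθ.eventually (by simp)] with z hz
    exact hz.differentiableAt (by simp)
  obtain ⟨r, hr, hsub⟩ := Metric.mem_nhds_iff.1 (inter_mem (inter_mem hs ht) hd)
  refine ⟨r, hr, K + 2 * L, by positivity, fun x hx y hy => ?_, fun z v hz₁ hz₂ => ?_⟩
  · have := hK.dist_le_mul x (hsub hx).1.1 y (hsub hy).1.1
    rw [dist_eq_norm, dist_eq_norm] at this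
    refine this.trans (mul_le_mul_of_nonneg_right ?_ (norm_nonneg _))
    have : (0 : ℝ) ≤ L := L.2
    linarith
  · refine ((convex_ball a r).norm_second_difference_le (fun x hx => (hsub hx).2)
      (hL.mono fun x hx => (hsub hx).1.2) (mem_ball_of_add_of_sub hz₁ hz₂) hz₁ hz₂).trans ?_
    refine mul_le_mul_of_nonneg_right ?_ (by positivity)
    have : (0 : ℝ) ≤ K := K.2
    linarith

/-- `g` is Lipschitz and semiconcave near `a`. -/
def IsSemiconcaveAt (g : E → ℝ) (a : E) : Prop :=
  ∃ r > 0, ∃ K ≥ 0, (∀ x ∈ ball a r, ∀ y ∈ ball a r, |g x - g y| ≤ K * ‖x - y‖) ∧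
    ∀ z v, z + v ∈ ball a r → z - v ∈ ball a r → g (z + v) + g (z - v) ≤ 2 * g z + K * ‖v‖ ^ 2

theorem IsSemiconcaveAt.congr {g h : E → ℝ} {a : E} (hg : IsSemiconcaveAt g a)
    (hh : g =ᶠ[𝓝 a] h) : IsSemiconcaveAt h a := by
  obtain ⟨r, hr, K, hK, hLip, hsc⟩ := hg
  obtain ⟨r', hr', heq⟩ := Metric.eventually_nhds_iff_ball.1 hh
  have h₁ : ball a (min r r') ⊆ ball a r := ball_subset_ball (min_le_left _ _)
  have h₂ : ball a (min r r') ⊆ ball a r' := ball_subset_ball (min_le_right _ _)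
  refine ⟨min r r', lt_min hr hr', K, hK, fun x hx y hy => ?_, fun z v hz hz' => ?_⟩
  · rw [← heq x (h₂ hx), ← heq y (h₂ hy)]
    exact hLip x (h₁ hx) y (h₁ hy)
  · rw [← heq _ (h₂ hz), ← heq _ (h₂ hz'), ← heq _ (h₂ (mem_ball_of_add_of_sub hz hz'))]
    exact hsc z v (h₁ hz) (h₁ hz')

/-- The midpoint of `θ (z + v)` and `θ (z - v)` misses `θ z` by `O(‖v‖²)`; the Lipschitz bound on
`g` absorbs this error, which is why it is carried along with semiconcavity. -/
theorem IsSemiconcaveAt.comp {g : E' → ℝ} {θ : E → E'} {a : E} (hg : IsSemiconcaveAt g (θ a))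
    (hθ : ContDiffAt ℝ 2 θ a) : IsSemiconcaveAt (fun z => g (θ z)) a := by
  obtain ⟨r, hr, K, hK, hLip, hsc⟩ := hg
  obtain ⟨s, hs, L, hL, hθL, hθ₂⟩ := hθ.exists_second_difference_le
  obtain ⟨t, ht, hsub⟩ := Metric.mem_nhds_iff.1
    (inter_mem (hθ.continuousAt.preimage_mem_nhds (ball_mem_nhds _ hr)) (ball_mem_nhds a hs))
  refine ⟨t, ht, K * L + K * L ^ 2, by positivity, fun x hx y hy => ?_, fun z v hz₁ hz₂ => ?_⟩
  · have h₁ := hLip _ (hsub hx).1 _ (hsub hy).1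
    have h₂ := mul_le_mul_of_nonneg_left (hθL x (hsub hx).2 y (hsub hy).2) hK
    have h₃ : 0 ≤ K * L ^ 2 * ‖x - y‖ := by positivity
    linarith
  · have hz := mem_ball_of_add_of_sub hz₁ hz₂
    set m₁ := θ (z + v)
    set m₂ := θ (z - v)
    have hm : (1 / 2 : ℝ) • (m₁ + m₂) ∈ ball (θ a) r := by
      refine mem_ball_of_add_of_sub (v := (1 / 2 : ℝ) • (m₁ - m₂)) ?_ ?_
      · rw [show (1 / 2 : ℝ) • (m₁ + m₂) + (1 / 2 : ℝ) • (m₁ - m₂) = m₁ by module]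
        exact (hsub hz₁).1
      · rw [show (1 / 2 : ℝ) • (m₁ + m₂) - (1 / 2 : ℝ) • (m₁ - m₂) = m₂ by module]
        exact (hsub hz₂).1
    have h₁ := hsc ((1 / 2 : ℝ) • (m₁ + m₂)) ((1 / 2 : ℝ) • (m₁ - m₂))
      (by
        rw [show (1 / 2 : ℝ) • (m₁ + m₂) + (1 / 2 : ℝ) • (m₁ - m₂) = m₁ by module]
        exact (hsub hz₁).1)
      (by
        rw [show (1 / 2 : ℝ) • (m₁ + m₂) - (1 / 2 : ℝ) • (m₁ - m₂) = m₂ by module]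
        exact (hsub hz₂).1)
    rw [show (1 / 2 : ℝ) • (m₁ + m₂) + (1 / 2 : ℝ) • (m₁ - m₂) = m₁ by module,
      show (1 / 2 : ℝ) • (m₁ + m₂) - (1 / 2 : ℝ) • (m₁ - m₂) = m₂ by module] at h₁
    have h₂ := le_of_abs_le (hLip _ hm _ (hsub hz).1)
    have h₃ : ‖(1 / 2 : ℝ) • (m₁ + m₂) - θ z‖ ≤ 1 / 2 * (L * ‖v‖ ^ 2) := by
      rw [show (1 / 2 : ℝ) • (m₁ + m₂) - θ z = (1 / 2 : ℝ) • (m₁ + m₂ - (2 : ℝ) • θ z) by module,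
        norm_smul, Real.norm_eq_abs, abs_of_pos (by norm_num : (0 : ℝ) < 1 / 2)]
      exact mul_le_mul_of_nonneg_left (hθ₂ z v (hsub hz₁).2 (hsub hz₂).2) (by norm_num)
    have h₄ : ‖(1 / 2 : ℝ) • (m₁ - m₂)‖ ≤ L * ‖v‖ := by
      rw [norm_smul, Real.norm_eq_abs, abs_of_pos (by norm_num : (0 : ℝ) < 1 / 2)]
      have := hθL _ (hsub hz₁).2 _ (hsub hz₂).2
      rw [show z + v - (z - v) = (2 : ℝ) • v by module, norm_smul, Real.norm_eq_abs, abs_two]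
        at this
      linarith
    have h₅ : K * ‖(1 / 2 : ℝ) • (m₁ - m₂)‖ ^ 2 ≤ K * (L * ‖v‖) ^ 2 := by gcongr
    have h₆ := mul_le_mul_of_nonneg_left h₃ hK
    nlinarith

/-- In finite dimension a concave function on an open set is locally Lipschitz, and adding a
quadratic preserves this. -/
theorem IsSemiconcaveAt.of_concaveOn {F : Type*} [NormedAddCommGroup F] [InnerProductSpace ℝ F]
    [FiniteDimensional ℝ F] {g : F → ℝ} {Ω : Set F} {K : ℝ} (hΩ : IsOpen Ω)
    (hg : ConcaveOn ℝ Ω fun z => g z - K * ‖z‖ ^ 2) {a : F} (ha : a ∈ Ω) :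
    IsSemiconcaveAt g a := by
  obtain ⟨L, t, ht, hL⟩ := hg.locallyLipschitzOn hΩ ha
  rw [hΩ.nhdsWithin_eq ha] at ht
  have hquad : LipschitzNear (fun q : ℝ × F => q.1 + K * ‖q.2‖ ^ 2) (g a - K * ‖a‖ ^ 2, a) :=
    (contDiff_fst.add (contDiff_const.mul (contDiff_snd.norm_sq ℝ))).contDiffAt.lipschitzNear
  have hlip : LipschitzNear g a := by
    have h₁ : LipschitzNear (fun z => g z - K * ‖z‖ ^ 2) a := ⟨L, t, ht, hL⟩
    have h₂ : LipschitzNear (fun z : F => z) a := contDiffAt_id.lipschitzNear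
    refine (LipschitzNear.comp (f := fun z => (g z - K * ‖z‖ ^ 2, z)) hquad
      (h₁.prodMk h₂)).congr (Eventually.of_forall fun z => ?_)
    simp
  obtain ⟨L', s, hs, hL'⟩ := hlip
  obtain ⟨r, hr, hsub⟩ := Metric.mem_nhds_iff.1 (inter_mem hs (hΩ.mem_nhds ha))
  refine ⟨r, hr, L' + 2 * |K|, by positivity, fun x hx y hy => ?_, fun z v hz₁ hz₂ => ?_⟩
  · have := hL'.dist_le_mul x (hsub hx).1 y (hsub hy).1
    rw [Real.dist_eq, dist_eq_norm] at this
    refine this.trans (mul_le_mul_of_nonneg_right ?_ (norm_nonneg _))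
    linarith [abs_nonneg K]
  · have := hg.2 (hsub hz₁).2 (hsub hz₂).2 (by norm_num : (0 : ℝ) ≤ 1 / 2)
      (by norm_num : (0 : ℝ) ≤ 1 / 2) (by norm_num)
    rw [show (1 / 2 : ℝ) • (z + v) + (1 / 2 : ℝ) • (z - v) = z by module] at this
    simp only [smul_eq_mul] at this
    have h₁ := norm_sq_add_add_norm_sq_sub z v
    have h₂ := congrArg (K * ·) h₁
    beta_reduce at h₂
    have h₃ : K * ‖v‖ ^ 2 ≤ |K| * ‖v‖ ^ 2 := by
      gcongr
      exact le_abs_self K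
    have h₄ : 0 ≤ (L' : ℝ) * ‖v‖ ^ 2 := by positivity
    linarith

/-- A smooth cutoff of a function which is Lipschitz and semiconcave on a ball is semiconcave on
the whole space. -/
theorem exists_cutoff_mul_second_difference_le [FiniteDimensional ℝ E] {g ρ : E → ℝ} {a : E}
    {r K : ℝ} (hr : 0 < r)
    (hK : 0 ≤ K) (hLip : ∀ x ∈ ball a r, ∀ y ∈ ball a r, |g x - g y| ≤ K * ‖x - y‖)
    (hsc : ∀ z v, z + v ∈ ball a r → z - v ∈ ball a r →
      g (z + v) + g (z - v) ≤ 2 * g z + K * ‖v‖ ^ 2)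
    (hρ : ContDiff ℝ 2 ρ) (hρ₀ : ∀ z, 0 ≤ ρ z) (hρs : tsupport ρ ⊆ ball a (r / 2)) :
    (Continuous fun z => ρ z * g z) ∧ ∃ K' > 0, ∀ z v,
      ρ (z + v) * g (z + v) + ρ (z - v) * g (z - v) ≤ 2 * (ρ z * g z) + K' * ‖v‖ ^ 2 := by
  have hcs : HasCompactSupport ρ :=
    (isCompact_closedBall a (r / 2)).of_isClosed_subset (isClosed_tsupport ρ)
      (hρs.trans ball_subset_closedBall)
  have hzero : ∀ z, z ∉ ball a (r / 2) → ρ z = 0 := fun z hz =>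
    image_eq_zero_of_notMem_tsupport fun h => hz (hρs h)
  obtain ⟨R, hR⟩ : ∃ R, ∀ z, |ρ z| ≤ R := by
    obtain ⟨R, hR⟩ := hcs.exists_bound_of_continuous hρ.continuous
    exact ⟨R, hR⟩
  have hR0 : 0 ≤ R := (abs_nonneg _).trans (hR a)
  obtain ⟨L₁, hL₁⟩ := ContDiff.lipschitzWith_of_hasCompactSupport hcs hρ (by norm_num)
  obtain ⟨L₂, hL₂⟩ := ContDiff.lipschitzWith_of_hasCompactSupport (hcs.fderiv ℝ)
    (hρ.fderiv_right (m := 1) (by norm_num)) (by norm_num)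
  have hρ₁ : ∀ x y, |ρ x - ρ y| ≤ L₁ * ‖x - y‖ := fun x y => by
    simpa [dist_eq_norm] using hL₁.dist_le_mul x y
  have hρ₂ : ∀ z v, |ρ (z + v) + ρ (z - v) - 2 * ρ z| ≤ 2 * L₂ * ‖v‖ ^ 2 := fun z v => by
    have := convex_univ.norm_second_difference_le (θ := ρ)
      (fun x _ => (hρ.differentiable (by norm_num)) x) hL₂.lipschitzOnWith (mem_univ z)
      (mem_univ (z + v)) (mem_univ (z - v))
    simpa using this
  set B := |g a| + K * r with hB
  have hB0 : 0 ≤ B := by positivity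
  have hgB : ∀ z ∈ ball a r, |g z| ≤ B := fun z hz => by
    have h₁ := hLip z hz a (mem_ball_self hr)
    have h₂ : K * ‖z - a‖ ≤ K * r := by
      gcongr
      exact (mem_ball_iff_norm.1 hz).le
    have h₃ := abs_sub_abs_le_abs_sub (g z) (g a)
    linarith
  have hhalf : ball a (r / 2) ⊆ ball a r := ball_subset_ball (by linarith)
  have hprod : ∀ z, |ρ z * g z| ≤ R * B := fun z => by
    by_cases hz : z ∈ ball a (r / 2)
    · rw [abs_mul]
      exact mul_le_mul (hR z) (hgB z (hhalf hz)) (abs_nonneg _) hR0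
    · rw [hzero z hz, zero_mul, abs_zero]
      positivity
  constructor
  · rw [continuous_iff_continuousAt]
    intro z
    by_cases hz : z ∈ ball a r
    · have hcont : ContinuousOn g (ball a r) :=
        (LipschitzOnWith.of_dist_le_mul (K := Real.toNNReal K) fun x hx y hy => by
          rw [Real.coe_toNNReal _ hK, Real.dist_eq, dist_eq_norm]
          exact hLip x hx y hy).continuousOn
      exact hρ.continuous.continuousAt.mul (hcont.continuousAt (isOpen_ball.mem_nhds hz))
    · have hz' : z ∉ tsupport ρ := fun h => hz (hhalf (hρs h))
      refine (continuousAt_const (y := (0 : ℝ))).congr ?_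
      filter_upwards [(isClosed_tsupport ρ).isOpen_compl.mem_nhds hz'] with x hx
      rw [image_eq_zero_of_notMem_tsupport hx, zero_mul]
  · refine ⟨R * K + 2 * (L₁ * K) + B * (2 * L₂) + 64 * (R * B) / r ^ 2 + 1, by positivity,
      fun z v => ?_⟩
    have hp₁ : 0 ≤ (R * K + 2 * (L₁ * K) + B * (2 * L₂)) * ‖v‖ ^ 2 := by positivity
    have hp₂ : 0 ≤ 64 * (R * B) / r ^ 2 * ‖v‖ ^ 2 := by positivity
    have hp₃ := sq_nonneg ‖v‖
    rcases le_or_gt (r / 4) ‖v‖ with hv | hv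
    · have h₁ := le_of_abs_le (hprod (z + v))
      have h₂ := le_of_abs_le (hprod (z - v))
      have h₃ := neg_le_of_abs_le (hprod z)
      have h₄ : 64 * (R * B) / r ^ 2 * (r / 4) ^ 2 ≤ 64 * (R * B) / r ^ 2 * ‖v‖ ^ 2 := by gcongr
      have h₅ : 64 * (R * B) / r ^ 2 * (r / 4) ^ 2 = 4 * (R * B) := by
        field_simp
        ring
      linarith
    by_cases hin : z + v ∈ ball a r ∧ z - v ∈ ball a r
    · have hz := mem_ball_of_add_of_sub hin.1 hin.2
      have h₁ : ρ z * (g (z + v) + g (z - v) - 2 * g z) ≤ R * (K * ‖v‖ ^ 2) := by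
        refine (mul_le_mul_of_nonneg_left (c := K * ‖v‖ ^ 2) ?_ (hρ₀ z)).trans ?_
        · linarith [hsc z v hin.1 hin.2]
        · exact mul_le_mul_of_nonneg_right (le_of_abs_le (hR z)) (by positivity)
      have h₂ : (ρ (z + v) - ρ z) * (g (z + v) - g z) ≤ L₁ * ‖v‖ * (K * ‖v‖) := by
        have h₁ := hρ₁ (z + v) z
        have h₂ := hLip _ hin.1 _ hz
        rw [add_sub_cancel_left] at h₁ h₂
        refine (le_abs_self _).trans ?_
        rw [abs_mul]
        exact mul_le_mul h₁ h₂ (abs_nonneg _) (by positivity)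
      have h₃ : (ρ (z - v) - ρ z) * (g (z - v) - g z) ≤ L₁ * ‖v‖ * (K * ‖v‖) := by
        have h₁ := hρ₁ (z - v) z
        have h₂ := hLip _ hin.2 _ hz
        rw [sub_sub_cancel_left, norm_neg] at h₁ h₂
        refine (le_abs_self _).trans ?_
        rw [abs_mul]
        exact mul_le_mul h₁ h₂ (abs_nonneg _) (by positivity)
      have h₄ : g z * (ρ (z + v) + ρ (z - v) - 2 * ρ z) ≤ B * (2 * L₂ * ‖v‖ ^ 2) := by
        refine (le_abs_self _).trans ?_
        rw [abs_mul]
        exact mul_le_mul (hgB z hz) (hρ₂ z v) (abs_nonneg _) hB0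
      linarith
    · have hout : ∀ y, ‖y - z‖ ≤ r / 4 → ρ y = 0 := by
        intro y hy
        refine hzero y fun hmem => hin ?_
        rw [mem_ball_iff_norm] at hmem
        have h₀ : ‖z - a‖ ≤ ‖y - a‖ + ‖y - z‖ := by
          rw [show z - a = (y - a) - (y - z) by abel]
          exact norm_sub_le _ _
        constructor
        · rw [mem_ball_iff_norm, show z + v - a = (z - a) + v by abel]
          exact (norm_add_le _ _).trans_lt (by linarith)
        · rw [mem_ball_iff_norm, show z - v - a = (z - a) - v by abel]
          exact (norm_sub_le _ _).trans_lt (by linarith)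
      rw [hout (z + v) (by rw [add_sub_cancel_left]; exact hv.le),
        hout (z - v) (by rw [sub_sub_cancel_left, norm_neg]; exact hv.le),
        hout z (by rw [sub_self, norm_zero]; positivity)]
      linarith

end LocalRegularity

/-! ### Passage to the manifold: charts, extension by zero, partition of unity. -/

section Manifold

open Set Filter Topology Metric

theorem eventuallyEq_transition {M E : Type*} [TopologicalSpace M] [TopologicalSpace E]
    (e e' : OpenPartialHomeomorph M E) (u : M → ℝ) {z : E} (hz : z ∈ e.target)
    (hz' : e.symm z ∈ e'.source) :
    (fun y => (u ∘ e'.symm) (e' (e.symm y))) =ᶠ[𝓝 z] u ∘ e.symm := by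
  filter_upwards [(e.continuousAt_symm hz).preimage_mem_nhds (e'.open_source.mem_nhds hz')]
    with y hy
  simp only [Function.comp_apply]
  rw [e'.left_inv hy]

variable {n : ℕ} {M : Type*} [TopologicalSpace M] [ChartedSpace (EuclideanSpace ℝ (Fin n)) M]

theorem contDiffAt_transition {e e' : OpenPartialHomeomorph M (EuclideanSpace ℝ (Fin n))}
    (he : e ∈ IsManifold.maximalAtlas (𝓡 n) ∞ M) (he' : e' ∈ IsManifold.maximalAtlas (𝓡 n) ∞ M)
    {z : EuclideanSpace ℝ (Fin n)} (hz : z ∈ e.target) (hz' : e.symm z ∈ e'.source) :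
    ContDiffAt ℝ 2 (fun y => e' (e.symm y)) z :=
  ((contMDiffAt_of_mem_maximalAtlas he' hz').comp z
    (contMDiffAt_symm_of_mem_maximalAtlas he hz)).contDiffAt.of_le
    (WithTop.coe_le_coe.2 le_top)

theorem IsC11At.transition {e e' : OpenPartialHomeomorph M (EuclideanSpace ℝ (Fin n))}
    (he : e ∈ IsManifold.maximalAtlas (𝓡 n) ∞ M) (he' : e' ∈ IsManifold.maximalAtlas (𝓡 n) ∞ M)
    {u : M → ℝ} {p : M} (hp : p ∈ e.source) (hp' : p ∈ e'.source)
    (hu : IsC11At (u ∘ e'.symm) (e' p)) : IsC11At (u ∘ e.symm) (e p) := by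
  have hz := e.map_source hp
  have hz' : e.symm (e p) ∈ e'.source := by rwa [e.left_inv hp]
  refine (IsC11At.comp (θ := fun y => e' (e.symm y)) ?_
    (contDiffAt_transition he he' hz hz')).congr (eventuallyEq_transition e e' u hz hz')
  rwa [e.left_inv hp]

theorem IsSemiconcaveAt.transition {e e' : OpenPartialHomeomorph M (EuclideanSpace ℝ (Fin n))}
    (he : e ∈ IsManifold.maximalAtlas (𝓡 n) ∞ M) (he' : e' ∈ IsManifold.maximalAtlas (𝓡 n) ∞ M)
    {u : M → ℝ} {p : M} (hp : p ∈ e.source) (hp' : p ∈ e'.source)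
    (hu : IsSemiconcaveAt (u ∘ e'.symm) (e' p)) : IsSemiconcaveAt (u ∘ e.symm) (e p) := by
  have hz := e.map_source hp
  have hz' : e.symm (e p) ∈ e'.source := by rwa [e.left_inv hp]
  refine (IsSemiconcaveAt.comp (θ := fun y => e' (e.symm y)) ?_
    (contDiffAt_transition he he' hz hz')).congr (eventuallyEq_transition e e' u hz hz')
  rwa [e.left_inv hp]

/-- `u : M → ℝ` is `C^{1,1}` near `p`, in every chart. -/
def IsC11NearPoint (n : ℕ) {M : Type*} [TopologicalSpace M]
    [ChartedSpace (EuclideanSpace ℝ (Fin n)) M] (u : M → ℝ) (p : M) : Prop :=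
  ∀ e ∈ IsManifold.maximalAtlas (𝓡 n) ∞ M, p ∈ e.source → IsC11At (u ∘ e.symm) (e p)

theorem IsC11NearPoint.of_chart {e : OpenPartialHomeomorph M (EuclideanSpace ℝ (Fin n))}
    (he : e ∈ IsManifold.maximalAtlas (𝓡 n) ∞ M) {u : M → ℝ} {p : M} (hp : p ∈ e.source)
    (hu : IsC11At (u ∘ e.symm) (e p)) : IsC11NearPoint n u p :=
  fun _ he' hp' => hu.transition he' he hp' hp

theorem IsC11NearPoint.congr {u v : M → ℝ} {p : M} (hu : IsC11NearPoint n u p)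
    (h : u =ᶠ[𝓝 p] v) : IsC11NearPoint n v p := fun e he hp => by
  refine (hu e he hp).congr ?_
  have : Tendsto e.symm (𝓝 (e p)) (𝓝 p) := e.tendsto_symm hp
  exact this.eventually h

theorem isC11NearPoint_const (b : ℝ) (p : M) : IsC11NearPoint n (fun _ : M => b) p :=
  fun _ _ _ => isC11At_const b _

theorem IsC11NearPoint.add {u v : M → ℝ} {p : M} (hu : IsC11NearPoint n u p)
    (hv : IsC11NearPoint n v p) : IsC11NearPoint n (fun x => u x + v x) p :=
  fun e he hp => (hu e he hp).add (hv e he hp)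

theorem IsC11NearPoint.sum {ι : Type*} (s : Finset ι) {u : ι → M → ℝ} {p : M}
    (hu : ∀ i ∈ s, IsC11NearPoint n (u i) p) : IsC11NearPoint n (fun x => ∑ i ∈ s, u i x) p := by
  classical
  induction s using Finset.induction_on with
  | empty => simpa using isC11NearPoint_const 0 p
  | insert i s hi ih =>
    simp only [Finset.sum_insert hi]
    exact (hu i (Finset.mem_insert_self i s)).add
      (ih fun j hj => hu j (Finset.mem_insert_of_mem hj))

theorem isC11_of_forall_isC11NearPoint [IsManifold (𝓡 n) ∞ M] {u : M → ℝ}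
    (hu : ∀ p, IsC11NearPoint n u p) : IsC11 n u := by
  refine ⟨fun p => ?_, fun φ hφ z hz => ?_⟩
  · have : IsManifold (𝓡 n) 1 M := IsManifold.of_le (n := ∞) (mod_cast le_top)
    have h := (hu p _ (IsManifold.chart_mem_maximalAtlas p)
      (mem_chart_source (EuclideanSpace ℝ (Fin n)) p)).contDiffAt
    rw [contMDiffAt_iff_source]
    exact h.contMDiffAt.contMDiffWithinAt
  · have h := hu (φ.symm z) φ hφ (φ.map_target hz)
    rw [φ.right_inv hz] at h
    obtain ⟨K, s, hs, hK⟩ := h.2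
    exact ⟨K, s, mem_nhdsWithin_of_mem_nhds hs, hK⟩

theorem ConcaveOn.ciInf {E A : Type*} [AddCommGroup E] [Module ℝ E] [Nonempty A] {Ω : Set E}
    {h : A → E → ℝ} (hh : ∀ a, ConcaveOn ℝ Ω (h a)) (hb : ∀ z, BddBelow (range fun a => h a z)) :
    ConcaveOn ℝ Ω fun z => ⨅ a, h a z := by
  refine ⟨(hh (Classical.arbitrary A)).1, fun x hx y hy s t hs ht hst => le_ciInf fun a => ?_⟩
  refine le_trans ?_ ((hh a).2 hx hy hs ht hst)
  simp only [smul_eq_mul]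
  exact add_le_add (mul_le_mul_of_nonneg_left (ciInf_le (hb x) a) hs)
    (mul_le_mul_of_nonneg_left (ciInf_le (hb y) a) ht)

/-- `T⁻ u` inherits the semiconcavity of the functions `c (y, ·)`. -/
theorem isSemiconcaveAt_laxOleinik [IsManifold (𝓡 n) ∞ M] [Nonempty M] {c : M → M → ℝ}
    {u : M → ℝ} (hcb : ∃ B, ∀ x y, |c x y| ≤ B) (hub : ∃ D, ∀ x, |u x| ≤ D)
    (hc : EquiLocallySemiconcave n fun x : M => fun y : M => c x y) (b : ℝ) (p : M) :
    IsSemiconcaveAt ((fun x => laxOleinik c u x + b) ∘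
      (chartAt (EuclideanSpace ℝ (Fin n)) p).symm) (chartAt (EuclideanSpace ℝ (Fin n)) p p) := by
  obtain ⟨m, φ, K, hφ, hcov, hsc⟩ := hc
  obtain ⟨i, hi⟩ := mem_iUnion.1 (hcov ▸ mem_univ p)
  refine IsSemiconcaveAt.transition (IsManifold.chart_mem_maximalAtlas p) (hφ i)
    (mem_chart_source _ p) hi ?_
  refine IsSemiconcaveAt.of_concaveOn (K := K i) (φ i).open_target ?_ ((φ i).map_source hi)
  have hbd : ∀ x, BddBelow (range fun y => u y + c y x) :=
    bddBelow_range_add_of_bounded hcb hub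
  -- With the quadratic and the constants moved inside the infimum, each member is concave with the
  -- common `K i`.
  have hrw : (fun z => ((fun x => laxOleinik c u x + b) ∘ (φ i).symm) z - K i * ‖z‖ ^ 2) =
      fun z => ⨅ y, (c y ((φ i).symm z) - K i * ‖z‖ ^ 2 + (u y + b)) := by
    funext z
    simp only [Function.comp_apply, laxOleinik]
    rw [add_sub_assoc, ciInf_add (hbd _)]
    congr 1
    funext y
    ring
  rw [hrw]
  refine ConcaveOn.ciInf (fun y => (hsc i y).add_const _) fun z => ?_
  obtain ⟨a, ha⟩ := hbd ((φ i).symm z)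
  refine ⟨a - K i * ‖z‖ ^ 2 + b, ?_⟩
  rintro _ ⟨y, rfl⟩
  have := ha ⟨y, rfl⟩
  simp only at this ⊢
  linarith

/-- A bump function read in a chart, extended by zero. -/
theorem contDiff_indicator_comp_symm {e : OpenPartialHomeomorph M (EuclideanSpace ℝ (Fin n))}
    [T2Space M] [CompactSpace M]
    (he : e ∈ IsManifold.maximalAtlas (𝓡 n) ∞ M) {ρ : M → ℝ} (hρ : ContMDiff (𝓡 n) 𝓘(ℝ, ℝ) ∞ ρ)
    (hs : tsupport ρ ⊆ e.source) :
    ContDiff ℝ 2 (e.target.indicator (ρ ∘ e.symm)) ∧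
      tsupport (e.target.indicator (ρ ∘ e.symm)) ⊆ e '' tsupport ρ := by
  -- The image of the support is compact, hence closed in `ℝⁿ`; this makes extension by zero smooth
  -- outside the chart target.
  have hcomp : IsCompact (e '' tsupport ρ) :=
    (isClosed_tsupport ρ).isCompact.image_of_continuousOn (e.continuousOn.mono hs)
  have hsupp : tsupport (e.target.indicator (ρ ∘ e.symm)) ⊆ e '' tsupport ρ := by
    refine closure_minimal (fun z hz => ?_) hcomp.isClosed
    have hzt : z ∈ e.target := mem_of_indicator_ne_zero hz
    rw [Function.mem_support, indicator_of_mem hzt] at hz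
    exact ⟨e.symm z, subset_tsupport ρ hz, e.right_inv hzt⟩
  refine ⟨contDiff_iff_contDiffAt.2 fun z => ?_, hsupp⟩
  by_cases hz : z ∈ e.target
  · have h : ContDiffAt ℝ 2 (ρ ∘ e.symm) z :=
      ((hρ _).comp z (contMDiffAt_symm_of_mem_maximalAtlas he hz)).contDiffAt.of_le
        (WithTop.coe_le_coe.2 le_top)
    refine h.congr_of_eventuallyEq ?_
    filter_upwards [e.open_target.mem_nhds hz] with y hy
    rw [indicator_of_mem hy]
  · have hz' : z ∉ e '' tsupport ρ := by
      rintro ⟨x, hx, rfl⟩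
      exact hz (e.map_source (hs hx))
    refine (contDiffAt_const (c := (0 : ℝ))).congr_of_eventuallyEq ?_
    filter_upwards [hcomp.isClosed.isOpen_compl.mem_nhds hz'] with y hy
    exact image_eq_zero_of_notMem_tsupport fun h => hy (hsupp h)

/-- Localized insertion, in one chart. -/
theorem exists_isC11NearPoint_between_mul [T2Space M] [CompactSpace M]
    {e : OpenPartialHomeomorph M (EuclideanSpace ℝ (Fin n))}
    (he : e ∈ IsManifold.maximalAtlas (𝓡 n) ∞ M) {f g : M → ℝ} (hfg : ∀ x, f x ≤ g x)
    {a : EuclideanSpace ℝ (Fin n)}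
    (hg : IsSemiconcaveAt (g ∘ e.symm) a)
    (hf : IsSemiconcaveAt ((fun x => -f x) ∘ e.symm) a) :
    ∃ r > 0, ∀ ρ : M → ℝ, ContMDiff (𝓡 n) 𝓘(ℝ, ℝ) ∞ ρ → (∀ x, 0 ≤ ρ x) →
      tsupport ρ ⊆ e.source ∩ e ⁻¹' ball a r →
      ∃ w : M → ℝ, (∀ p, IsC11NearPoint n w p) ∧ (∀ x, ρ x * f x ≤ w x) ∧
        (∀ x, w x ≤ ρ x * g x) ∧
        ∀ x, 0 < ρ x → f x < g x → ρ x * f x < w x ∧ w x < ρ x * g x := by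
  obtain ⟨r₁, hr₁, K₁, hK₁, hLip₁, hsc₁⟩ := hg
  obtain ⟨r₂, hr₂, K₂, hK₂, hLip₂, hsc₂⟩ := hf
  -- Half the radius, because the cutoff lemma requires support in the half ball.
  refine ⟨min r₁ r₂ / 2, half_pos (lt_min hr₁ hr₂), fun ρ hρ hρ₀ hρs => ?_⟩
  obtain ⟨hσ, hσs⟩ := contDiff_indicator_comp_symm he hρ fun x hx => (hρs hx).1
  set σ := e.target.indicator (ρ ∘ e.symm) with hσdef
  have hσ₀ : ∀ z, 0 ≤ σ z := fun z => indicator_nonneg (fun y _ => hρ₀ _) z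
  have hσball : tsupport σ ⊆ ball a (min r₁ r₂ / 2) := fun z hz => by
    obtain ⟨x, hx, rfl⟩ := hσs hz
    exact (hρs hx).2
  have hσe : ∀ x ∈ e.source, σ (e x) = ρ x := fun x hx => by
    rw [hσdef, indicator_of_mem (e.map_source hx), Function.comp_apply, e.left_inv hx]
  obtain ⟨hGc, L₁, hL₁, hG⟩ := exists_cutoff_mul_second_difference_le hr₁ hK₁ hLip₁ hsc₁ hσ hσ₀
    (hσball.trans (ball_subset_ball (by linarith [min_le_left r₁ r₂])))
  obtain ⟨hFc, L₂, hL₂, hF⟩ := exists_cutoff_mul_second_difference_le hr₂ hK₂ hLip₂ hsc₂ hσ hσ₀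
    (hσball.trans (ball_subset_ball (by linarith [min_le_right r₁ r₂])))
  simp only [Function.comp_apply, mul_neg] at hG hF hGc hFc
  obtain ⟨w, hFw, hwG, hlt, q, hq, hqL⟩ := exists_quadratic_bound_between
    (F := fun z => σ z * f (e.symm z)) (G := fun z => σ z * g (e.symm z)) (K := L₁ + L₂)
    (hFc.neg.congr fun z => neg_neg _) hGc (fun z => mul_le_mul_of_nonneg_left (hfg _) (hσ₀ z))
    (by positivity)
    (fun z v => by
      have := hF z v
      have : 0 ≤ L₁ * ‖v‖ ^ 2 := by positivity
      linarith)
    (fun z v => by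
      have := hG z v
      have : 0 ≤ L₂ * ‖v‖ ^ 2 := by positivity
      linarith)
  have hρout : ∀ x ∉ e.source, ρ x = 0 := fun x hx =>
    image_eq_zero_of_notMem_tsupport fun h => hx (hρs h).1
  -- Where the cutoff vanishes `w` is squeezed to zero, so it extends by zero to the manifold
  -- without loss of regularity.
  have hw0 : ∀ z, σ z = 0 → w z = 0 := fun z hz => by
    have h₁ := hFw z
    have h₂ := hwG z
    rw [hz, zero_mul] at h₁ h₂
    exact le_antisymm h₂ h₁
  have hwC11 : ∀ z, IsC11At w z := fun z => by
    have hfd : fderiv ℝ w = q := funext fun y => (hq y).fderiv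
    exact ⟨Eventually.of_forall fun y => (hq y).differentiableAt, _, univ, univ_mem,
      hfd ▸ hqL.lipschitzOnWith⟩
  let W : M → ℝ := e.source.indicator fun x => w (e x)
  have hWin : ∀ x ∈ e.source, W x = w (e x) := fun x hx => indicator_of_mem hx _
  have hWout : ∀ x ∉ e.source, W x = 0 := fun x hx => indicator_of_notMem hx _
  have hW0 : ∀ x, ρ x = 0 → W x = 0 := fun x hx => by
    by_cases hxs : x ∈ e.source
    · rw [hWin x hxs, hw0 _ (by rw [hσe x hxs, hx])]
    · exact hWout x hxs
  refine ⟨W, fun p => ?_, fun x => ?_, fun x => ?_, fun x hx hfgx => ?_⟩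
  · by_cases hp : p ∈ e.source
    · refine IsC11NearPoint.of_chart he hp ((hwC11 (e p)).congr ?_)
      filter_upwards [e.open_target.mem_nhds (e.map_source hp)] with y hy
      rw [Function.comp_apply, hWin _ (e.map_target hy), e.right_inv hy]
    · refine (isC11NearPoint_const 0 p).congr ?_
      have hp' : p ∉ tsupport ρ := fun h => hp (hρs h).1
      filter_upwards [(isClosed_tsupport ρ).isOpen_compl.mem_nhds hp'] with x hx
      exact (hW0 x (image_eq_zero_of_notMem_tsupport hx)).symm
  · by_cases hx : x ∈ e.source
    · have := hFw (e x)
      rwa [hσe x hx, e.left_inv hx, ← hWin x hx] at this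
    · rw [hWout x hx, hρout x hx, zero_mul]
  · by_cases hx : x ∈ e.source
    · have := hwG (e x)
      rwa [hσe x hx, e.left_inv hx, ← hWin x hx] at this
    · rw [hWout x hx, hρout x hx, zero_mul]
  · have hxs : x ∈ e.source := by
      by_contra h
      exact hx.ne' (hρout x h)
    have := hlt (e x)
    rw [hσe x hxs, e.left_inv hxs, ← hWin x hxs] at this
    exact this (mul_lt_mul_of_pos_left hfgx hx)

/-- Insertion of a `C^{1,1}` function between a locally semiconvex and a locally semiconcave
function on a compact manifold (Ilmanen's lemma). -/
theorem exists_isC11_between [IsManifold (𝓡 n) ∞ M] [T2Space M] [CompactSpace M] {f g : M → ℝ}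
    (hfg : ∀ x, f x ≤ g x)
    (hg : ∀ p, IsSemiconcaveAt (g ∘ (chartAt (EuclideanSpace ℝ (Fin n)) p).symm)
      (chartAt (EuclideanSpace ℝ (Fin n)) p p))
    (hf : ∀ p, IsSemiconcaveAt ((fun x => -f x) ∘ (chartAt (EuclideanSpace ℝ (Fin n)) p).symm)
      (chartAt (EuclideanSpace ℝ (Fin n)) p p)) :
    ∃ w : M → ℝ, IsC11 n w ∧ (∀ x, f x ≤ w x) ∧ (∀ x, w x ≤ g x) ∧
      ∀ x, f x < g x → f x < w x ∧ w x < g x := by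
  choose r hr hloc using fun p => exists_isC11NearPoint_between_mul
    (IsManifold.chart_mem_maximalAtlas p) hfg (hg p) (hf p)
  let U : M → Set M := fun p => (chartAt (EuclideanSpace ℝ (Fin n)) p).source ∩
    chartAt (EuclideanSpace ℝ (Fin n)) p ⁻¹' ball (chartAt (EuclideanSpace ℝ (Fin n)) p p) (r p)
  have hUo : ∀ p, IsOpen (U p) := fun p =>
    (chartAt (EuclideanSpace ℝ (Fin n)) p).isOpen_inter_preimage isOpen_ball
  have hUp : ∀ p, U p ∈ 𝓝 p := fun p =>
    (hUo p).mem_nhds ⟨mem_chart_source _ p, mem_ball_self (hr p)⟩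
  obtain ⟨t, -, ht⟩ := isCompact_univ.elim_nhds_subcover U fun p _ => hUp p
  obtain ⟨ρ, hρ⟩ := SmoothPartitionOfUnity.exists_isSubordinate (𝓡 n) (isClosed_univ (X := M))
    (fun i : t => U i) (fun i => hUo i) (by simpa [iUnion_subtype] using ht)
  choose w hw hfw hwg hlt using fun i : t =>
    hloc i (ρ i) (ρ i).contMDiff (ρ.nonneg i) (hρ i)
  have hsum : ∀ x, ∑ i : t, ρ i x = 1 := fun x => by
    rw [← finsum_eq_sum_of_fintype]
    exact ρ.sum_eq_one (mem_univ x)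
  have hsumf : ∀ (h : M → ℝ) x, ∑ i : t, ρ i x * h x = h x := fun h x => by
    rw [← Finset.sum_mul, hsum, one_mul]
  refine ⟨fun x => ∑ i : t, w i x,
    isC11_of_forall_isC11NearPoint fun p => IsC11NearPoint.sum _ fun i _ => hw i p,
    fun x => ?_, fun x => ?_, fun x hx => ?_⟩
  · rw [← hsumf f x]
    exact Finset.sum_le_sum fun i _ => hfw i x
  · rw [← hsumf g x]
    exact Finset.sum_le_sum fun i _ => hwg i x
  -- One index with `ρ i x > 0` makes the whole sum strict.
  · obtain ⟨i, hi⟩ := ρ.exists_pos_of_mem (mem_univ x)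
    constructor
    · rw [← hsumf f x]
      exact Finset.sum_lt_sum (fun i _ => hfw i x) ⟨i, Finset.mem_univ i, (hlt i x hi hx).1⟩
    · rw [← hsumf g x]
      exact Finset.sum_lt_sum (fun i _ => hwg i x) ⟨i, Finset.mem_univ i, (hlt i x hi hx).2⟩

end Manifold

/-! ### Assembly. -/

theorem mainTheorem8 (n : ℕ) {M : Type*} [TopologicalSpace M]
    [ChartedSpace (EuclideanSpace ℝ (Fin n)) M] [IsManifold (𝓡 n) ∞ M]
    [CompactSpace M] [T2Space M] [Nonempty M]
    (c : M → M → ℝ) (hc : Continuous fun p : M × M => c p.1 p.2)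
    (hc₁ : EquiLocallySemiconcave n fun x : M => fun y : M => c x y)
    (hc₂ : EquiLocallySemiconcave n fun y : M => fun x : M => c x y) :
    ∃ c₀ : ℝ, IsCriticalValue c c₀ ∧
      ∃ u₁ : M → ℝ, IsStrictSubsolution c c₀ u₁ ∧ IsC11 n u₁ := by
  have : SecondCountableTopology M :=
    ChartedSpace.secondCountable_of_sigmaCompact (EuclideanSpace ℝ (Fin n)) M
  have hcb := exists_abs_le_of_continuous_cost hc
  obtain ⟨c₀, hc₀⟩ := exists_isLeast_isSubsolution hc
  refine ⟨c₀, isCriticalValue_of_isLeast hc hc₀, ?_⟩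
  obtain ⟨u, -, hu⟩ := exists_continuous_isStrictSubsolution hc hc₀.1
  have hg : IsSubsolution c c₀ fun x => laxOleinik c u x + c₀ := hu.1.laxOleinik hcb
  obtain ⟨D, hD⟩ := hg.bounded hcb
  obtain ⟨B, hB⟩ := hcb
  obtain ⟨w, hw, hfw, hwg, hlt⟩ := exists_isC11_between (n := n)
    (f := fun x => laxOleinikPos c (fun x => laxOleinik c u x + c₀) x - c₀)
    (g := fun x => laxOleinik c u x + c₀) hg.laxOleinikPos_sub_le
    (fun p => isSemiconcaveAt_laxOleinik ⟨B, hB⟩ (hu.1.bounded ⟨B, hB⟩) hc₁ c₀ p)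
    -- Up to a constant, the negative of the lower function is `T⁻` for the transposed cost applied
    -- to `-g`; here the semiconcavity in the first variable enters.
    (fun p => by
      have := isSemiconcaveAt_laxOleinik (c := fun a b => c b a)
        (u := fun y => -(laxOleinik c u y + c₀)) ⟨B, fun x y => hB y x⟩
        ⟨D, fun x => by rw [abs_neg]; exact hD x⟩ hc₂ c₀ p
      convert this using 2
      funext x
      simp only [laxOleinikPos]
      ring)
  exact ⟨w, hu.of_between ⟨B, hB⟩ (fun _ => rfl) (fun _ => rfl) hfw hwg hlt, hw⟩
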